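/- For $N \ge 0$ let $\vec x=\{x_1,\dots,x_N\}$ and $\vec x'=\{x_1',\dots,x_N'\}$ be sets of integer variables. A *difference bounds constraint* is a finite (possibly empty) conjunction of atomic propositions $y-z\le\alpha$ with distinct $y,z\in\vec x\cup\vec x'$ and $\alpha\in\mathbb Z$; a relation $R\subseteq\mathbb Z^N\times\mathbb Z^N$ is a *difference bounds relation* if some difference bounds constraint $\varphi(\vec x,\vec x')$ defines it. The binary size of an integer $c$ is $\lceil\log_2|c|\rceil$ if $|c|>2$ and $2$ otherwise. The binary size of an atomic proposition, written as $a_0+\sum_{v\in\vec x\cup\vec x'}a_v v\le 0$, is the sum of the binary sizes of all its coefficients $a_0$, $a_v$ (zero coefficients included), and the binary size $\mathrm{bin}(\varphi)$ of a constraint is the sum over its atomic propositions, counted with multiplicity. The binary size $\mathrm{bin}(R)$ of a difference bounds relation $R$ is the least binary size of a difference bounds constraint defining $R$. Composition is $R\circ S=\{(\nu,\nu'):\exists\mu\;(\nu,\mu)\in R\wedge(\mu,\nu')\in S\}$, and $R^n$ is the $n$-fold composition of $R$ with itself. **Lemma.** The difference bounds relations form a poly-logarithmic class of relations. That is: 0.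 If $R,S\subseteq\mathbb Z^N\times\mathbb Z^N$ are difference bounds relations, then so is $R\circ S$. 1. There are integers $p,q>0$ such that $\mathrm{bin}(R^n)=\mathcal O(\mathrm{bin}(R)^p\cdot\max(1,\log_2 n)^q)$ for all $N$, all difference bounds relations $R\subseteq\mathbb Z^N\times\mathbb Z^N$ and all $n>0$, with an absolute implied constant. In fact this holds with $p=3$ and $q=1$: $\mathrm{bin}(R^n)=\mathcal O(\mathrm{bin}(R)^3\cdot\max(1,\log_2 n))$. 2. There are an integer $r>0$ and a program, for a random access machine with logarithmic (bit) cost, that on input $N$ and any two difference bounds constraints $P(\vec x,\vec x')$, $Q(\vec x,\vec x')$ over $N$ variables (formulae being encoded by the lists of all their coefficients) outputs, in time $\mathcal O(\max(1,\mathrm{bin}(P)+\mathrm{bin}(Q))^r)$ with an absolute implied constant, a difference bounds constraint defining the composition of the relations defined by $P$ and $Q$. -/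

import Mathlib

namespace DiffBounds

/-! ## Quantifier-free Presburger formulae `φ(x, x')` and their binary size -/

/-- The variables `x ∪ x'` of a formula `φ(x, x')` with `x = {x_0, …, x_{N-1}}`:
`Sum.inl i` is `x_i` and `Sum.inr i` is `x'_i`. -/
abbrev Var (N : ℕ) : Type := Fin N ⊕ Fin N

/-- A valuation of the unprimed variables. -/
abbrev Val (N : ℕ) : Type := Fin N → ℤ

/-- Binary relations on valuations. -/
abbrev Rel (N : ℕ) : Type := Val N → Val N → Prop

/-- A linear term `a_0 + ∑_v a_v v` over the variables `x ∪ x'`. -/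
structure LinTerm (N : ℕ) where
  const : ℤ
  coeff : Var N → ℤ

/-- Value of a linear term, `x` being read from `ν` and `x'` from `ν'`. -/
def LinTerm.eval {N : ℕ} (t : LinTerm N) (ν ν' : Val N) : ℤ :=
  t.const + ∑ v, t.coeff v * Sum.elim ν ν' v

/-- Quantifier-free Presburger formulae: Boolean combinations of the atomic propositions `t ≤ 0`
and `t ≡ 0 (mod c)` with `c > 0`. -/
inductive QFPA (N : ℕ) : Type where
  | tru : QFPA N
  | le : LinTerm N → QFPA N
  | cong : ℕ+ → LinTerm N → QFPA N
  | neg : QFPA N → QFPA N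
  | and : QFPA N → QFPA N → QFPA N
  | or : QFPA N → QFPA N → QFPA N

/-- `(ν, ν') ⊨ φ`. -/
def QFPA.Sat {N : ℕ} (ν ν' : Val N) : QFPA N → Prop
  | .tru => True
  | .le t => t.eval ν ν' ≤ 0
  | .cong c t => ((c : ℕ) : ℤ) ∣ t.eval ν ν'
  | .neg φ => ¬ φ.Sat ν ν'
  | .and φ ψ => φ.Sat ν ν' ∧ ψ.Sat ν ν'
  | .or φ ψ => φ.Sat ν ν' ∨ ψ.Sat ν ν'

/-- `φ` defines the relation `R`. -/
def QFPA.Defines {N : ℕ} (φ : QFPA N) (R : Rel N) : Prop :=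
  ∀ ν ν', R ν ν' ↔ φ.Sat ν ν'

/-- Binary size of an integer: `⌈log₂ |c|⌉` if `|c| > 2`, and `2` otherwise. -/
def binInt (c : ℤ) : ℕ := if 2 < c.natAbs then Nat.clog 2 c.natAbs else 2

/-- Binary size of a linear term: the sum of the sizes of all its coefficients `a_0`, `a_v`. -/
def LinTerm.bin {N : ℕ} (t : LinTerm N) : ℕ := binInt t.const + ∑ v, binInt (t.coeff v)

/-- Binary size of a formula: the sum of the sizes of its (occurrences of) atomic propositions. -/
def QFPA.bin {N : ℕ} : QFPA N → ℕ
  | .tru => 0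
  | .le t => t.bin
  | .cong c t => t.bin + binInt ((c : ℕ) : ℤ)
  | .neg φ => φ.bin
  | .and φ ψ => φ.bin + ψ.bin
  | .or φ ψ => φ.bin + ψ.bin

/-! ## Classes of relations -/

/-- A set of formulae `φ(x, x')`, for every number `N` of variables. -/
abbrev FormulaSet : Type := (N : ℕ) → Set (QFPA N)

/-- `R` is definable by a formula of `𝓡`. -/
def Definable (𝓡 : FormulaSet) {N : ℕ} (R : Rel N) : Prop :=
  ∃ φ ∈ 𝓡 N, φ.Defines R

/-- A class of relations: the definable relations are closed under composition. -/
def IsRelationClass (𝓡 : FormulaSet) : Prop :=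
  ∀ (N : ℕ) (R S : Rel N), Definable 𝓡 R → Definable 𝓡 S → Definable 𝓡 (Relation.Comp R S)

/-- The powers of a relation: `R⁰ = Id` and `Rⁿ⁺¹ = Rⁿ ∘ R`. -/
def relPow {N : ℕ} (R : Rel N) : ℕ → Rel N
  | 0 => fun ν ν' => ν = ν'
  | n + 1 => Relation.Comp (relPow R n) R

/-- Binary size of an `𝓡`-definable relation: the least size of a formula of `𝓡` defining it. -/
noncomputable def relBin (𝓡 : FormulaSet) {N : ℕ} (R : Rel N) : ℕ :=
  sInf {b | ∃ φ ∈ 𝓡 N, φ.Defines R ∧ φ.bin = b}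

/-- `bin(Rⁿ) = O(bin(R)^p · (log₂ n)^q)` for all `𝓡`-definable `R` and all `n > 0`, the constant
depending on `𝓡` only.  The maximum matters for `n = 1` only, where `log₂ n = 0`. -/
def PowerSizeBound (𝓡 : FormulaSet) (p q : ℕ) : Prop :=
  ∃ C : ℝ, ∀ (N : ℕ) (R : Rel N), Definable 𝓡 R → ∀ n : ℕ, 0 < n →
    (relBin 𝓡 (relPow R n) : ℝ) ≤ C * (relBin 𝓡 R : ℝ) ^ p * (max 1 (Real.logb 2 n)) ^ q

/-! ## A random access machine with logarithmic (bit) cost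

Programs are while-programs over arrays of integers, indexed by integers.  Every operation is
charged the bit length of all integers it handles, addresses included; a multiplication is
charged the product of the lengths of its factors. -/

/-- `s a i` is the content of cell `i` of array `a`. -/
abbrev Store : Type := ℕ → ℤ → ℤ

/-- Bit length of an integer, with one more bit for the sign. -/
def len (z : ℤ) : ℕ := z.natAbs.size + 1

inductive Expr : Type where
  | lit : ℤ → Expr
  | get : ℕ → Expr → Expr
  | add : Expr → Expr → Expr
  | sub : Expr → Expr → Expr
  | mul : Expr → Expr → Expr

def Expr.eval (s : Store) : Expr → ℤ
  | .lit c => c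
  | .get a i => s a (i.eval s)
  | .add e f => e.eval s + f.eval s
  | .sub e f => e.eval s - f.eval s
  | .mul e f => e.eval s * f.eval s

/-- Time for the evaluation of an expression. -/
def Expr.cost (s : Store) : Expr → ℕ
  | .lit c => len c
  | .get a i => i.cost s + len (i.eval s) + len (s a (i.eval s))
  | .add e f => e.cost s + f.cost s + len (e.eval s) + len (f.eval s)
  | .sub e f => e.cost s + f.cost s + len (e.eval s) + len (f.eval s)
  | .mul e f => e.cost s + f.cost s + len (e.eval s) * len (f.eval s)

/-- Programs: `assign a i e` is `a[i] := e`; `ite e c d` is `if e > 0 then c else d`;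
`loop e c` is `while e > 0 do c`. -/
inductive Prog : Type where
  | skip : Prog
  | assign : ℕ → Expr → Expr → Prog
  | seq : Prog → Prog → Prog
  | ite : Expr → Prog → Prog → Prog
  | loop : Expr → Prog → Prog

/-- The store after the assignment `a[i] := z`. -/
def Store.write (s : Store) (a : ℕ) (i z : ℤ) : Store :=
  Function.update s a (Function.update (s a) i z)

/-- `Exec c s s' t`: the program `c`, started in `s`, halts in `s'` after time `t`. -/
inductive Exec : Prog → Store → Store → ℕ → Prop where
  | skip (s : Store) : Exec .skip s s 1
  | assign (s : Store) (a : ℕ) (i e : Expr) :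
      Exec (.assign a i e) s (s.write a (i.eval s) (e.eval s))
        (i.cost s + e.cost s + len (i.eval s) + len (e.eval s))
  | seq {c d : Prog} {s s' s'' : Store} {t t' : ℕ} :
      Exec c s s' t → Exec d s' s'' t' → Exec (.seq c d) s s'' (t + t')
  | ite_pos {e : Expr} {c d : Prog} {s s' : Store} {t : ℕ} :
      0 < e.eval s → Exec c s s' t →
        Exec (.ite e c d) s s' (e.cost s + len (e.eval s) + t)
  | ite_neg {e : Expr} {c d : Prog} {s s' : Store} {t : ℕ} :
      ¬ 0 < e.eval s → Exec d s s' t →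
        Exec (.ite e c d) s s' (e.cost s + len (e.eval s) + t)
  | loop_stop {e : Expr} {c : Prog} {s : Store} :
      ¬ 0 < e.eval s → Exec (.loop e c) s s (e.cost s + len (e.eval s))
  | loop_step {e : Expr} {c : Prog} {s s' s'' : Store} {t t' : ℕ} :
      0 < e.eval s → Exec c s s' t → Exec (.loop e c) s' s'' t' →
        Exec (.loop e c) s s'' (e.cost s + len (e.eval s) + t + t')

/-- A list `l` is stored in an array as its length in cell `0`, followed by its entries. -/
def HoldsList (m : ℤ → ℤ) (l : List ℤ) : Prop :=
  m 0 = l.length ∧ ∀ (i : ℕ) (h : i < l.length), m ((i : ℤ) + 1) = l[i]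

/-- The initial store: array `a` holds the list `ls[a]`, and every other cell holds `0`. -/
def initStore (ls : List (List ℤ)) : Store := fun a i =>
  let l := ls.getD a []
  if 0 ≤ i then ((l.length : ℤ) :: l).getD i.toNat 0 else 0

/-- A linear term as the list of its coefficients (constant, unprimed, primed). -/
def LinTerm.code {N : ℕ} (t : LinTerm N) : List ℤ :=
  t.const :: (List.ofFn (fun i => t.coeff (Sum.inl i)) ++ List.ofFn (fun i => t.coeff (Sum.inr i)))

/-- A formula as a list of integers, in prefix notation. -/
def QFPA.code {N : ℕ} : QFPA N → List ℤ
  | .tru => [0]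
  | .le t => 1 :: t.code
  | .cong c t => 2 :: ((c : ℕ) : ℤ) :: t.code
  | .neg φ => 3 :: φ.code
  | .and φ ψ => 4 :: (φ.code ++ ψ.code)
  | .or φ ψ => 5 :: (φ.code ++ ψ.code)

/-- Composition is computable in time `O((bin P + bin Q)^r)`: one program, given `N` and two
formulae of `𝓡` over `N` variables, halts within that time with a formula of `𝓡` defining the
composition of the two relations in array `0`. -/
def CompositionTimeBound (𝓡 : FormulaSet) (r : ℕ) : Prop :=
  ∃ (c : Prog) (C : ℕ), ∀ (N : ℕ) (P Q : QFPA N), P ∈ 𝓡 N → Q ∈ 𝓡 N →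
    ∃ φ ∈ 𝓡 N, φ.Defines (Relation.Comp (fun ν ν' => P.Sat ν ν') (fun ν ν' => Q.Sat ν ν')) ∧
      ∃ (s : Store) (t : ℕ), Exec c (initStore [[(N : ℤ)], P.code, Q.code]) s t ∧
        HoldsList (s 0) φ.code ∧ t ≤ C * (max 1 (P.bin + Q.bin)) ^ r

/-- Poly-logarithmic sets of formulae. -/
def PolyLogarithmic (𝓡 : FormulaSet) : Prop :=
  ∃ p q r : ℕ, 0 < p ∧ 0 < q ∧ 0 < r ∧ PowerSizeBound 𝓡 p q ∧ CompositionTimeBound 𝓡 r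

/-! ## Difference bounds relations -/

/-- The atomic proposition `y - z ≤ α`, that is, `-α + y - z ≤ 0`. -/
def dbAtom {N : ℕ} (y z : Var N) (α : ℤ) : QFPA N :=
  .le ⟨-α, Pi.single y 1 - Pi.single z 1⟩

/-- A finite conjunction; the empty one is `tru`. -/
def conj {N : ℕ} (l : List (QFPA N)) : QFPA N := l.foldr .and .tru

/-- The difference bounds constraints: finite conjunctions of atomic propositions `y - z ≤ α`
with distinct `y, z ∈ x ∪ x'` and `α ∈ ℤ`. -/
def DB : FormulaSet := fun N =>
  {φ | ∃ l : List (QFPA N), (∀ a ∈ l, ∃ (y z : Var N) (α : ℤ), y ≠ z ∧ a = dbAtom y z α) ∧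
    φ = conj l}

end DiffBounds

/-!
The proof rests on the elimination of unknowns from systems of difference constraints
`x i - x j ≤ d`, represented by `DGraph`.  To eliminate `x k`, each pair of constraints
`x i - x k ≤ a`, `x k - x j ≤ b` contributes its consequence `x i - x j ≤ a + b`, and only the least
bound is kept for each pair `(i, j)`.  As all coefficients are `±1`, this describes the projection
exactly over `ℤ` (`DGraph.exists_update_sat`).  The relation `R ∘ S` is the projection of
`R(x, y) ∧ S(y, x')` along the `N` unknowns `y`, whence the closure under composition
(`sat_toAtoms_composeGraph`).

*Size of powers.*  One elimination at most doubles the largest weight, so a composition multiplies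
it by at most `2 ^ N`.  Splitting `Rⁿ = R^⌈n/2⌉ ∘ R^⌊n/2⌋` repeatedly, the weights of `Rⁿ` are at
most `2 ^ (N ⌈log₂ n⌉)` times those of `R` (`exists_atoms_relPow`), and there are at most `(2N)²`
constraints, each with `O(N)` coefficients.  As a nonempty constraint over `N` variables has size at
least `4N`, the size of `Rⁿ` is `O(N² (N log n + bin R + N)) = O((bin R)³ log n)`.

*Time of composition.*  A program performs the same elimination on a matrix, between parsing the two
input formulae and writing the output.  It uses no multiplication, so that each step lengthens the
integers in the store by a bounded number of bits; the bit cost is therefore polynomial in the number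
of steps and the length of the input (`Run.exists_exec`).  This makes it enough to count steps, which
is done together with the verification, in a calculus of weakest preconditions (`WP`).  If both
inputs are the empty constraint, their size is `0` while `N` is arbitrary: in this case the program
has to answer in constant time, without reading `N`.
-/

namespace DiffBounds

/-! ### Difference graphs and the elimination of a vertex -/

/-- A finite system of difference constraints in the unknowns `x 0, x 1, …`: `edge i j = some d`
stands for `x i - x j ≤ d`, and `bad` records that a contradiction `0 ≤ c` with `c < 0` has been
derived. -/
@[ext] structure DGraph where
  edge : ℕ → ℕ → Option ℤ
  bad : Bool

namespace DGraph

/-- The system without constraints. -/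
def empty : DGraph := ⟨fun _ _ => none, false⟩

/-- `x` satisfies the constraints between unknowns of `A`. -/
def Sat (G : DGraph) (A : Set ℕ) (x : ℕ → ℤ) : Prop :=
  G.bad = false ∧ ∀ i ∈ A, ∀ j ∈ A, ∀ d, G.edge i j = some d → x i - x j ≤ d

/-- Add the constraint `x y - x z ≤ c`. -/
def relax (G : DGraph) (y z : ℕ) (c : ℤ) : DGraph :=
  if y = z then { G with bad := G.bad || decide (c < 0) }
  else { G with
    edge := fun i j => if i = y ∧ j = z then
      some (match G.edge y z with
        | none => c
        | some d => min d c) else G.edge i j }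

/-- Add the consequence of the constraints `(i, k)` and `(k, j)`, if both are present. -/
def relaxVia (G : DGraph) (k i j : ℕ) : DGraph :=
  match G.edge i k, G.edge k j with
  | some a, some b => G.relax i j (a + b)
  | _, _ => G

/-- All edges have distinct ends below `W`. -/
def Supported (G : DGraph) (W : ℕ) : Prop :=
  ∀ i j d, G.edge i j = some d → i < W ∧ j < W ∧ i ≠ j

/-- All weights are bounded by `B` in absolute value. -/
def WeightLE (G : DGraph) (B : ℤ) : Prop :=
  ∀ i j d, G.edge i j = some d → |d| ≤ B

theorem relax_edge_of_ne {G : DGraph} {y z i j : ℕ} {c : ℤ} (h : ¬ (i = y ∧ j = z)) :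
    (G.relax y z c).edge i j = G.edge i j := by
  unfold relax; split_ifs <;> simp [h]

theorem relax_edge_or {G : DGraph} {y z i j : ℕ} {c d : ℤ}
    (h : (G.relax y z c).edge i j = some d) :
    G.edge i j = some d ∨ (i = y ∧ j = z ∧ y ≠ z ∧ d = c) := by
  unfold relax at h
  split_ifs at h with h1
  · exact .inl h
  · dsimp only at h
    split_ifs at h with h2
    · obtain ⟨rfl, rfl⟩ := h2
      cases hE : G.edge i j with
      | none => simp [hE] at h; exact .inr ⟨rfl, rfl, h1, h.symm⟩
      | some e =>
        simp only [hE, Option.some.injEq] at h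
        rcases min_choice e c with h3 | h3
        · left; rw [← h, h3]
        · right; exact ⟨rfl, rfl, h1, by rw [← h, h3]⟩
    · exact .inl h

theorem relax_edge_mono {G : DGraph} {y z i j : ℕ} {c d : ℤ} (h : G.edge i j = some d) :
    ∃ d' ≤ d, (G.relax y z c).edge i j = some d' := by
  unfold relax
  split_ifs with h1
  · exact ⟨d, le_rfl, h⟩
  · by_cases h2 : i = y ∧ j = z
    · obtain ⟨rfl, rfl⟩ := h2
      exact ⟨min d c, min_le_left _ _, by simp [h]⟩
    · exact ⟨d, le_rfl, by simp [h2, h]⟩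

theorem relax_edge_self {G : DGraph} {y z : ℕ} {c : ℤ} (h : y ≠ z) :
    ∃ d ≤ c, (G.relax y z c).edge y z = some d := by
  unfold relax
  rw [if_neg h]
  cases hE : G.edge y z with
  | none => exact ⟨c, le_rfl, by simp⟩
  | some e => exact ⟨min e c, min_le_right _ _, by simp⟩

theorem relax_bad {G : DGraph} {y z : ℕ} {c : ℤ} :
    (G.relax y z c).bad = (G.bad || (decide (y = z) && decide (c < 0))) := by
  unfold relax
  split_ifs with h <;> simp [h]

theorem relax_supported {G : DGraph} {W y z : ℕ} {c : ℤ} (hG : G.Supported W) (hy : y < W)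
    (hz : z < W) : (G.relax y z c).Supported W := by
  intro i j d h
  rcases relax_edge_or h with h | ⟨rfl, rfl, h, -⟩
  · exact hG _ _ _ h
  · exact ⟨hy, hz, h⟩

theorem relax_weightLE {G : DGraph} {B : ℤ} {y z : ℕ} {c : ℤ} (hG : G.WeightLE B)
    (hc : |c| ≤ B) : (G.relax y z c).WeightLE B := by
  intro i j d h
  rcases relax_edge_or h with h | ⟨-, -, -, rfl⟩
  · exact hG _ _ _ h
  · exact hc

theorem sat_relax {G : DGraph} {A : Set ℕ} {y z : ℕ} {c : ℤ} {x : ℕ → ℤ} (hy : y ∈ A)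
    (hz : z ∈ A) : (G.relax y z c).Sat A x ↔ G.Sat A x ∧ x y - x z ≤ c := by
  unfold Sat
  rw [relax_bad]
  constructor
  · rintro ⟨hb, he⟩
    simp only [Bool.or_eq_false_iff, Bool.and_eq_false_imp, decide_eq_true_eq,
      decide_eq_false_iff_not, not_lt] at hb
    refine ⟨⟨hb.1, fun i hi j hj d h => ?_⟩, ?_⟩
    · obtain ⟨d', hd, h'⟩ := relax_edge_mono (y := y) (z := z) (c := c) h
      exact (he i hi j hj d' h').trans hd
    · by_cases hyz : y = z
      · subst hyz; simpa using hb.2 rfl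
      · obtain ⟨d, hd, h⟩ := relax_edge_self (G := G) (c := c) hyz
        exact (he y hy z hz d h).trans hd
  · rintro ⟨⟨hb, he⟩, hc⟩
    refine ⟨?_, fun i hi j hj d h => ?_⟩
    · simp only [hb, Bool.false_or, Bool.and_eq_false_imp, decide_eq_true_eq,
        decide_eq_false_iff_not, not_lt]
      rintro rfl; simpa using hc
    · rcases relax_edge_or h with h | ⟨rfl, rfl, -, rfl⟩
      · exact he i hi j hj d h
      · exact hc

theorem sat_relaxVia {G : DGraph} {k i j : ℕ} {x : ℕ → ℤ} :
    (G.relaxVia k i j).Sat Set.univ x ↔ G.Sat Set.univ x := by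
  unfold relaxVia
  split
  · rename_i a b ha hb
    rw [sat_relax (Set.mem_univ _) (Set.mem_univ _), and_iff_left_iff_imp]
    intro h
    have h1 := h.2 i trivial k trivial a ha
    have h2 := h.2 k trivial j trivial b hb
    linarith
  · rfl

end DGraph

/-- `iter f n a = f (n-1) (… (f 1 (f 0 a)))`, the meaning of a `for` loop. -/
def iter {α : Type*} (f : ℕ → α → α) : ℕ → α → α
  | 0, a => a
  | n + 1, a => f n (iter f n a)

theorem iter_induction {α : Type*} {f : ℕ → α → α} {a : α} (I : ℕ → α → Prop) (n : ℕ)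
    (h0 : I 0 a) (hs : ∀ k < n, ∀ b, I k b → I (k + 1) (f k b)) : I n (iter f n a) := by
  induction n with
  | zero => exact h0
  | succ n ih => exact hs n n.lt_succ_self _ (ih fun k hk => hs k (hk.trans n.lt_succ_self))

namespace DGraph

/-- Add all consequences of two constraints that share the unknown `x k`. -/
def elim (W k : ℕ) (G : DGraph) : DGraph :=
  iter (fun i G => iter (fun j G => G.relaxVia k i j) W G) W G

/-- What holds in the course of `elim`, started with `G`, when the pairs in `S` have been
treated and the current system is `H`. -/
structure ElimInv (W k : ℕ) (G H : DGraph) (S : ℕ → ℕ → Prop) : Prop where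
  bad : H.bad = false → G.bad = false
  mono : ∀ i j d, G.edge i j = some d → ∃ d' ≤ d, H.edge i j = some d'
  col : ∀ i, H.edge i k = G.edge i k
  row : ∀ j, H.edge k j = G.edge k j
  done : ∀ i j a b, S i j → G.edge i k = some a → G.edge k j = some b →
    (i ≠ j → ∃ d ≤ a + b, H.edge i j = some d) ∧ (i = j → H.bad = false → 0 ≤ a + b)
  supported : H.Supported W
  weight : ∀ B, 0 ≤ B → G.WeightLE B → H.WeightLE (2 * B)
  sound : ∀ x, H.Sat Set.univ x ↔ G.Sat Set.univ x

theorem ElimInv.step {W k : ℕ} {G H : DGraph} {S : ℕ → ℕ → Prop} (h : ElimInv W k G H S)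
    {i j : ℕ} (hi : i < W) (hj : j < W) :
    ElimInv W k G (H.relaxVia k i j) (fun i' j' => S i' j' ∨ (i' = i ∧ j' = j)) := by
  have hs : ∀ x, (H.relaxVia k i j).Sat Set.univ x ↔ G.Sat Set.univ x :=
    fun x => sat_relaxVia.trans (h.sound x)
  revert hs
  unfold relaxVia
  split
  · rename_i a b ha hb
    intro hs
    -- there are no loops, so the treated pair does not involve `k`
    have hik : i ≠ k := (h.supported _ _ _ ha).2.2
    have hkj : k ≠ j := (h.supported _ _ _ hb).2.2
    refine ⟨fun hb' => h.bad ?_, ?_, fun i' => ?_, fun j' => ?_, ?_,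
      relax_supported h.supported hi hj, fun B hB hG => ?_, hs⟩
    · rw [relax_bad] at hb'
      exact (Bool.or_eq_false_iff.1 hb').1
    · intro i' j' d hd
      obtain ⟨d', hd', h1⟩ := h.mono i' j' d hd
      obtain ⟨d'', hd'', h2⟩ := relax_edge_mono (y := i) (z := j) (c := a + b) h1
      exact ⟨d'', hd''.trans hd', h2⟩
    · rw [relax_edge_of_ne (by tauto), h.col]
    · rw [relax_edge_of_ne (by tauto), h.row]
    · intro i' j' a' b' hS ha' hb'
      rcases hS with hS | ⟨rfl, rfl⟩
      · obtain ⟨h1, h2⟩ := h.done i' j' a' b' hS ha' hb'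
        refine ⟨fun hne => ?_, fun he hbad => h2 he ?_⟩
        · obtain ⟨d, hd, h3⟩ := h1 hne
          obtain ⟨d', hd', h4⟩ := relax_edge_mono (y := i) (z := j) (c := a + b) h3
          exact ⟨d', hd'.trans hd, h4⟩
        · rw [relax_bad] at hbad
          exact (Bool.or_eq_false_iff.1 hbad).1
      · rw [h.col, ha'] at ha
        rw [h.row, hb'] at hb
        cases ha; cases hb
        refine ⟨fun hne => relax_edge_self hne, fun he hbad => ?_⟩
        rw [relax_bad] at hbad
        simpa [he] using (Bool.or_eq_false_iff.1 hbad).2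
    · refine relax_weightLE (h.weight B hB hG) ((abs_add_le a b).trans ?_)
      have h1 := hG _ _ _ (h.col i ▸ ha)
      have h2 := hG _ _ _ (h.row j ▸ hb)
      linarith
  · rename_i hno
    intro hs
    refine ⟨h.bad, h.mono, h.col, h.row, ?_, h.supported, h.weight, hs⟩
    intro i' j' a b hS ha hb
    rcases hS with hS | ⟨rfl, rfl⟩
    · exact h.done i' j' a b hS ha hb
    · exact absurd (h.row j' ▸ hb) (hno a b (h.col i' ▸ ha))

theorem elim_inv {W k : ℕ} {G : DGraph} (hG : G.Supported W) :
    ElimInv W k G (G.elim W k) (fun i j => i < W ∧ j < W) := by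
  have h0 : ElimInv W k G G (fun _ _ => False) :=
    ⟨id, fun i j d h => ⟨d, le_rfl, h⟩, fun _ => rfl, fun _ => rfl, by simp, hG,
      fun B hB h i j d hd => (h i j d hd).trans (by linarith), fun _ => Iff.rfl⟩
  have weaken : ∀ {H S S'}, ElimInv W k G H S → (∀ i j, S' i j → S i j) →
      ElimInv W k G H S' := fun h hS =>
    { h with done := fun i j a b hs => h.done i j a b (hS i j hs) }
  unfold elim
  refine weaken (iter_induction (fun i H => ElimInv W k G H (fun i' j' => i' < i ∧ j' < W)) W
    (weaken h0 (by simp)) ?_) (fun _ _ h => h)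
  intro i hi H hH
  refine weaken (iter_induction
    (fun j H => ElimInv W k G H (fun i' j' => (i' < i ∧ j' < W) ∨ (i' = i ∧ j' < j))) W
    (weaken hH (by simp)) ?_) ?_
  · intro j hj H' hH'
    refine weaken (hH'.step hi hj) ?_
    intro i' j' h
    omega
  · intro i' j' h
    omega

/-- A finite set of lower bounds and a finite set of upper bounds are compatible as soon as every
lower bound is below every upper bound. -/
theorem exists_between_bounds {L U : Set ℤ} (hL : L.Finite) (hU : U.Finite)
    (h : ∀ l ∈ L, ∀ u ∈ U, l ≤ u) : ∃ y, (∀ l ∈ L, l ≤ y) ∧ ∀ u ∈ U, y ≤ u := by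
  rcases U.eq_empty_or_nonempty with rfl | hne
  · obtain ⟨y, hy⟩ := hL.bddAbove
    exact ⟨y, fun l hl => hy hl, by simp⟩
  · obtain ⟨y, hy, hmin⟩ := Set.exists_min_image U id hU hne
    exact ⟨y, fun l hl => h l hl y hy, hmin⟩

/-- The system obtained by `elim` describes the projection along `x k`: this is the step of
Fourier-Motzkin elimination, exact over `ℤ` because all coefficients are `±1`. -/
theorem exists_update_sat {W k : ℕ} {G : DGraph} (hG : G.Supported W) {A : Set ℕ} {x : ℕ → ℤ}
    (h : (G.elim W k).Sat (A \ {k}) x) : ∃ y, G.Sat A (Function.update x k y) := by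
  have inv := elim_inv (k := k) hG
  obtain ⟨hbad, hsat⟩ := h
  set L : Set ℤ := {l | ∃ i a, i ∈ A ∧ G.edge i k = some a ∧ l = x i - a}
  set U : Set ℤ := {u | ∃ j b, j ∈ A ∧ G.edge k j = some b ∧ u = x j + b}
  have hL : L.Finite := by
    refine ((Set.finite_Iio W).image fun i => x i - (G.edge i k).getD 0).subset ?_
    rintro _ ⟨i, a, -, h1, rfl⟩
    exact ⟨i, (hG _ _ _ h1).1, by simp [h1]⟩
  have hU : U.Finite := by
    refine ((Set.finite_Iio W).image fun j => x j + (G.edge k j).getD 0).subset ?_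
    rintro _ ⟨j, b, -, h1, rfl⟩
    exact ⟨j, (hG _ _ _ h1).2.1, by simp [h1]⟩
  obtain ⟨y, hy1, hy2⟩ := exists_between_bounds hL hU (by
    rintro _ ⟨i, a, hi, ha, rfl⟩ _ ⟨j, b, hj, hb, rfl⟩
    have hiW := hG _ _ _ ha
    have hjW := hG _ _ _ hb
    obtain ⟨h1, h2⟩ := inv.done i j a b ⟨hiW.1, hjW.2.1⟩ ha hb
    by_cases hij : i = j
    · subst hij
      linarith [h2 rfl hbad]
    · obtain ⟨d, hd, he⟩ := h1 hij
      have := hsat i ⟨hi, hiW.2.2⟩ j ⟨hj, hjW.2.2.symm⟩ d he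
      linarith)
  refine ⟨y, inv.bad hbad, fun i hi j hj d hd => ?_⟩
  have hne := (hG _ _ _ hd).2.2
  by_cases hik : i = k
  · subst hik
    rw [Function.update_self, Function.update_of_ne hne.symm]
    linarith [hy2 (x j + d) ⟨j, d, hj, hd, rfl⟩]
  · by_cases hjk : j = k
    · subst hjk
      rw [Function.update_self, Function.update_of_ne hne]
      linarith [hy1 (x i - d) ⟨i, d, hi, hd, rfl⟩]
    · rw [Function.update_of_ne hik, Function.update_of_ne hjk]
      obtain ⟨d', hd', he⟩ := inv.mono i j d hd
      exact (hsat i ⟨hi, hik⟩ j ⟨hj, hjk⟩ d' he).trans hd'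

/-- Eliminate the unknowns `x N, …, x (2N-1)` from a system in `x 0, …, x (3N-1)`. -/
def elimMid (N : ℕ) (G : DGraph) : DGraph :=
  iter (fun m G => G.elim (3 * N) (N + m)) N G

/-- The indices of the unknowns that `elimMid` keeps. -/
def outer (N : ℕ) : Set ℕ := {i | ¬ (N ≤ i ∧ i < 2 * N)}

theorem elimMid_spec {N : ℕ} {G : DGraph} (hG : G.Supported (3 * N)) :
    (G.elimMid N).Supported (3 * N) ∧
    (∀ B, 0 ≤ B → G.WeightLE B → (G.elimMid N).WeightLE (2 ^ N * B)) ∧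
    ∀ x, (G.elimMid N).Sat (outer N) x ↔
      ∃ x', (∀ i ∈ outer N, x' i = x i) ∧ G.Sat Set.univ x' := by
  have key := iter_induction (f := fun m G => G.elim (3 * N) (N + m)) (a := G)
    (fun m H => H.Supported (3 * N) ∧
      (∀ B, 0 ≤ B → G.WeightLE B → H.WeightLE (2 ^ m * B)) ∧
      (∀ x, H.Sat Set.univ x ↔ G.Sat Set.univ x) ∧
      ∀ x, H.Sat {i | ¬ (N ≤ i ∧ i < N + m)} x →
        ∃ x', (∀ i, ¬ (N ≤ i ∧ i < N + m) → x' i = x i) ∧ G.Sat Set.univ x') N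
    ⟨hG, by simp, fun _ => Iff.rfl, fun x hx => ⟨x, fun _ _ => rfl, by
      convert hx using 1
      ext i; simp⟩⟩ (by
    rintro m - H ⟨h1, h2, h3, h4⟩
    have inv := elim_inv (k := N + m) h1
    refine ⟨inv.supported, fun B hB hw => ?_, fun x => (inv.sound x).trans (h3 x), fun x hx => ?_⟩
    · have := inv.weight _ (by positivity) (h2 B hB hw)
      rwa [pow_succ', mul_assoc]
    · obtain ⟨y, hy⟩ := exists_update_sat (A := {i | ¬ (N ≤ i ∧ i < N + m)}) h1 (x := x) (by
        convert hx using 1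
        ext i; simp; omega)
      obtain ⟨x', hx', hs⟩ := h4 _ hy
      refine ⟨x', fun i hi => ?_, hs⟩
      rw [hx' i (by omega), Function.update_of_ne (by omega)])
  obtain ⟨h1, h2, h3, h4⟩ := key
  refine ⟨h1, h2, fun x => ⟨fun hx => ?_, ?_⟩⟩
  · rw [← two_mul] at h4
    exact h4 x hx
  · rintro ⟨x', hx', hs⟩
    obtain ⟨hb, he⟩ := (h3 x').2 hs
    refine ⟨hb, fun i hi j hj d hd => ?_⟩
    rw [← hx' i hi, ← hx' j hj]
    exact he i trivial j trivial d hd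

end DGraph

/-! ### Composition of difference bounds constraints -/

/-- The atomic proposition `y - z ≤ α` as the triple `(y, z, α)`. -/
abbrev Atom (N : ℕ) : Type := Var N × Var N × ℤ

/-- The conjunction of a list of atomic propositions. -/
def atomsFormula {N : ℕ} (l : List (Atom N)) : QFPA N :=
  conj (l.map fun a => dbAtom a.1 a.2.1 a.2.2)

/-- The position of a variable in the list `x_0, …, x_{N-1}, x'_0, …, x'_{N-1}`. -/
def idx {N : ℕ} : Var N → ℕ := Sum.elim (fun i => i) (fun i => N + i)

theorem idx_lt {N : ℕ} (v : Var N) : idx v < 2 * N := by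
  rcases v with i | i <;> simp only [idx, Sum.elim_inl, Sum.elim_inr] <;> omega

theorem idx_injective {N : ℕ} : Function.Injective (idx : Var N → ℕ) := by
  rintro (i | i) (j | j) h <;> simp only [idx, Sum.elim_inl, Sum.elim_inr] at h
  · exact congrArg _ (Fin.ext h)
  · omega
  · omega
  · exact congrArg _ (Fin.ext (by omega))

/-- The variable at a given position. -/
def varAt (N : ℕ) [NeZero N] (i : ℕ) : Var N :=
  if i < N then Sum.inl (Fin.ofNat N i) else Sum.inr (Fin.ofNat N (i - N))

theorem idx_varAt {N : ℕ} [NeZero N] {i : ℕ} (h : i < 2 * N) : idx (varAt N i) = i := by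
  unfold varAt
  split_ifs with h1
  · simp [idx, Nat.mod_eq_of_lt h1]
  · simp only [idx, Sum.elim_inr, Fin.val_ofNat]
    rw [Nat.mod_eq_of_lt (by omega)]; omega

theorem mem_DB_iff {N : ℕ} {φ : QFPA N} :
    φ ∈ DB N ↔ ∃ l : List (Atom N), (∀ a ∈ l, a.1 ≠ a.2.1) ∧ φ = atomsFormula l := by
  constructor
  · rintro ⟨l, hl, rfl⟩
    induction l with
    | nil => exact ⟨[], by simp, rfl⟩
    | cons b l ih =>
      obtain ⟨l', h1, h2⟩ := ih fun a ha => hl a (List.mem_cons_of_mem _ ha)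
      obtain ⟨y, z, α, hne, rfl⟩ := hl b List.mem_cons_self
      refine ⟨(y, z, α) :: l', List.forall_mem_cons.2 ⟨hne, h1⟩, ?_⟩
      simp only [atomsFormula, conj, List.map_cons, List.foldr_cons] at h2 ⊢
      rw [h2]
  · rintro ⟨l, hl, rfl⟩
    refine ⟨_, fun a ha => ?_, rfl⟩
    obtain ⟨b, hb, rfl⟩ := List.mem_map.1 ha
    exact ⟨_, _, _, hl b hb, rfl⟩

theorem sat_dbAtom {N : ℕ} {y z : Var N} {α : ℤ} {ν ν' : Val N} :
    (dbAtom y z α).Sat ν ν' ↔ Sum.elim ν ν' y - Sum.elim ν ν' z ≤ α := by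
  simp only [dbAtom, QFPA.Sat, LinTerm.eval, Pi.sub_apply, sub_mul, Finset.sum_sub_distrib,
    Pi.single_apply, ite_mul, one_mul, zero_mul, Finset.sum_ite_eq',
    Finset.mem_univ, if_true]
  constructor <;> intro h <;> linarith

theorem sat_atomsFormula {N : ℕ} {l : List (Atom N)} {ν ν' : Val N} :
    (atomsFormula l).Sat ν ν' ↔
      ∀ a ∈ l, Sum.elim ν ν' a.1 - Sum.elim ν ν' a.2.1 ≤ a.2.2 := by
  induction l with
  | nil => simp [atomsFormula, conj, QFPA.Sat]
  | cons a l ih =>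
    have : (atomsFormula (a :: l)).Sat ν ν' ↔
        (dbAtom a.1 a.2.1 a.2.2).Sat ν ν' ∧ (atomsFormula l).Sat ν ν' := Iff.rfl
    rw [this, sat_dbAtom, ih, List.forall_mem_cons]

/-- Add atomic propositions to a system, the variable at position `i` being `x (i + off)`. -/
def DGraph.addAtoms {N : ℕ} (off : ℕ) (l : List (Atom N)) (G : DGraph) : DGraph :=
  l.foldl (fun G a => G.relax (idx a.1 + off) (idx a.2.1 + off) a.2.2) G

theorem DGraph.addAtoms_spec {N : ℕ} {off : ℕ} (hoff : off ≤ N) {l : List (Atom N)} {G : DGraph}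
    (hG : G.Supported (3 * N)) :
    (G.addAtoms off l).Supported (3 * N) ∧
    (∀ B, G.WeightLE B → (∀ a ∈ l, |a.2.2| ≤ B) → (G.addAtoms off l).WeightLE B) ∧
    ∀ x, (G.addAtoms off l).Sat Set.univ x ↔
      G.Sat Set.univ x ∧ ∀ a ∈ l, x (idx a.1 + off) - x (idx a.2.1 + off) ≤ a.2.2 := by
  induction l generalizing G with
  | nil => simp [addAtoms, hG]
  | cons a l ih =>
    have h1 := idx_lt a.1
    have h2 := idx_lt a.2.1
    obtain ⟨i1, i2, i3⟩ := ih (relax_supported (y := idx a.1 + off) (z := idx a.2.1 + off)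
      (c := a.2.2) hG (by omega) (by omega))
    refine ⟨i1, fun B hB hl => ?_, fun x => ?_⟩
    · rw [List.forall_mem_cons] at hl
      exact i2 B (relax_weightLE hB hl.1) hl.2
    · rw [List.forall_mem_cons, ← and_assoc, ← sat_relax (Set.mem_univ _) (Set.mem_univ _)]
      exact i3 x

/-- The system for `P(x, y) ∧ Q(y, x')`, with `y` eliminated. -/
def composeGraph {N : ℕ} (lP lQ : List (Atom N)) : DGraph :=
  ((DGraph.empty.addAtoms 0 lP).addAtoms N lQ).elimMid N

/-- The unknown for the variable at position `i` of `x, x'`. -/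
def vtx (N i : ℕ) : ℕ := if i < N then i else i + N

/-- The atomic proposition for the constraint on the variables at positions `i`, `j`, if any. -/
def DGraph.atomAt (N : ℕ) [NeZero N] (G : DGraph) (i j : ℕ) : List (Atom N) :=
  match G.edge (vtx N i) (vtx N j) with
  | some c => [(varAt N i, varAt N j, c)]
  | none => []

/-- The constraints on `x, x'` of a system, as a list of atomic propositions.  A contradiction is
expressed as `x_0 - x'_0 ≤ -1 ∧ x'_0 - x_0 ≤ -1`. -/
def DGraph.toAtoms (N : ℕ) [NeZero N] (G : DGraph) : List (Atom N) :=
  if G.bad then [(varAt N 0, varAt N N, -1), (varAt N N, varAt N 0, -1)]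
  else (List.range (2 * N)).flatMap fun i => (List.range (2 * N)).flatMap fun j => G.atomAt N i j

theorem DGraph.mem_atomAt {N : ℕ} [NeZero N] {G : DGraph} {i j : ℕ} {a : Atom N} :
    a ∈ G.atomAt N i j ↔ ∃ c, G.edge (vtx N i) (vtx N j) = some c ∧
      a = (varAt N i, varAt N j, c) := by
  unfold atomAt
  split <;> rename_i h <;> simp [h]

theorem zero_ne_varAt {N : ℕ} [NeZero N] : varAt N 0 ≠ varAt N N := by
  have := NeZero.pos N
  intro h
  have := congrArg idx h
  rw [idx_varAt (by omega), idx_varAt (by omega)] at this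
  omega

theorem DGraph.toAtoms_ne {N : ℕ} [NeZero N] {G : DGraph} (hG : G.Supported (3 * N)) :
    ∀ a ∈ G.toAtoms N, a.1 ≠ a.2.1 := by
  intro a ha
  unfold toAtoms at ha
  split_ifs at ha with h
  · simp only [List.mem_cons, List.not_mem_nil, or_false] at ha
    rcases ha with rfl | rfl
    · exact zero_ne_varAt
    · exact zero_ne_varAt.symm
  · simp only [List.mem_flatMap, List.mem_range, mem_atomAt] at ha
    obtain ⟨i, hi, j, hj, c, hc, rfl⟩ := ha
    intro he
    have := congrArg idx he
    rw [idx_varAt hi, idx_varAt hj] at this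
    exact (hG _ _ _ hc).2.2 (by rw [this])

theorem DGraph.toAtoms_weight {N : ℕ} [NeZero N] {G : DGraph} {B : ℤ} (hB : 1 ≤ B)
    (hG : G.WeightLE B) : ∀ a ∈ G.toAtoms N, |a.2.2| ≤ B := by
  intro a ha
  unfold toAtoms at ha
  split_ifs at ha with h
  · simp only [List.mem_cons, List.not_mem_nil, or_false] at ha
    rcases ha with rfl | rfl <;> simpa using hB
  · simp only [List.mem_flatMap, List.mem_range, mem_atomAt] at ha
    obtain ⟨i, hi, j, hj, c, hc, rfl⟩ := ha
    exact hG _ _ _ hc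

theorem DGraph.length_toAtoms_le {N : ℕ} [NeZero N] {G : DGraph} :
    (G.toAtoms N).length ≤ (2 * N) * (2 * N) := by
  have hN := NeZero.pos N
  unfold toAtoms
  split_ifs with h
  · simp only [List.length_cons, List.length_nil]; nlinarith
  · have h1 : ∀ i j, (G.atomAt N i j).length ≤ 1 := by
      intro i j; unfold atomAt; split <;> simp
    have h2 : ∀ (n : ℕ) (f : ℕ → List (Atom N)) (m : ℕ), (∀ i, (f i).length ≤ m) →
        ((List.range n).flatMap f).length ≤ n * m := by
      intro n f m hf
      induction n with
      | zero => simp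
      | succ n ih =>
        rw [List.range_succ, List.flatMap_append, List.length_append, List.flatMap_singleton]
        linarith [hf n]
    refine h2 _ _ _ fun i => (h2 _ _ 1 (h1 i)).trans (by simp)

theorem DGraph.sat_toAtoms {N : ℕ} [NeZero N] {G : DGraph} (hG : G.Supported (3 * N))
    (x : ℕ → ℤ) :
    (atomsFormula (G.toAtoms N)).Sat (fun i => x i) (fun i => x (2 * N + i)) ↔
      G.Sat (outer N) x := by
  have hN := NeZero.pos N
  have hx : ∀ i < 2 * N, Sum.elim (fun i : Fin N => x i) (fun i : Fin N => x (2 * N + i))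
      (varAt N i) = x (vtx N i) := by
    intro i hi
    unfold varAt vtx
    split_ifs with h
    · simp [Nat.mod_eq_of_lt h]
    · simp only [Sum.elim_inr, Fin.val_ofNat]
      rw [Nat.mod_eq_of_lt (by omega)]; congr 1; omega
  rw [sat_atomsFormula]
  unfold toAtoms
  split_ifs with h
  · refine iff_of_false (fun hs => ?_) (fun hs => by simp [hs.1] at h)
    simp only [List.forall_mem_cons] at hs
    have h1 := hs.1
    have h2 := hs.2.1
    linarith
  · simp only [List.mem_flatMap, List.mem_range, mem_atomAt]
    constructor
    · intro hs
      refine ⟨by simpa using h, fun i hi j hj d hd => ?_⟩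
      have hb := hG _ _ _ hd
      have key : ∀ i ∈ outer N, i < 3 * N → ∃ i' < 2 * N, vtx N i' = i := by
        intro i hi hlt
        simp only [outer, Set.mem_ofPred_eq] at hi
        by_cases h : i < N
        · exact ⟨i, by omega, by simp [vtx, h]⟩
        · refine ⟨i - N, by omega, ?_⟩
          unfold vtx
          rw [if_neg (by omega)]; omega
      obtain ⟨i', hi', rfl⟩ := key i hi hb.1
      obtain ⟨j', hj', rfl⟩ := key j hj hb.2.1
      rw [← hx _ hi', ← hx _ hj']
      exact hs _ ⟨i', hi', j', hj', d, hd, rfl⟩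
    · rintro ⟨-, hs⟩ a ⟨i, hi, j, hj, c, hc, rfl⟩
      dsimp only
      rw [hx _ hi, hx _ hj]
      refine hs _ ?_ _ ?_ c hc <;> simp only [outer, vtx, Set.mem_ofPred_eq] <;> split_ifs <;> omega

theorem composeGraph_supported {N : ℕ} (lP lQ : List (Atom N)) :
    (composeGraph lP lQ).Supported (3 * N) := by
  have h0 : DGraph.empty.Supported (3 * N) := by intro i j d h; simp [DGraph.empty] at h
  exact (DGraph.elimMid_spec (DGraph.addAtoms_spec le_rfl
    (DGraph.addAtoms_spec (Nat.zero_le _) h0).1).1).1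

theorem composeGraph_weightLE {N : ℕ} {lP lQ : List (Atom N)} {B : ℤ} (hB : 0 ≤ B)
    (hP : ∀ a ∈ lP, |a.2.2| ≤ B) (hQ : ∀ a ∈ lQ, |a.2.2| ≤ B) :
    (composeGraph lP lQ).WeightLE (2 ^ N * B) := by
  have h0 : DGraph.empty.Supported (3 * N) := by intro i j d h; simp [DGraph.empty] at h
  have hw : DGraph.empty.WeightLE B := by intro i j d h; simp [DGraph.empty] at h
  have h1 := DGraph.addAtoms_spec (l := lP) (Nat.zero_le _) h0
  have h2 := DGraph.addAtoms_spec (l := lQ) le_rfl h1.1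
  exact (DGraph.elimMid_spec h2.1).2.1 B hB (h2.2.1 B (h1.2.1 B hw hP) hQ)

/-- The computed constraint defines the composition of the two relations. -/
theorem sat_toAtoms_composeGraph {N : ℕ} [NeZero N] (lP lQ : List (Atom N)) :
    (atomsFormula ((composeGraph lP lQ).toAtoms N)).Defines
      (Relation.Comp (fun ν ν' => (atomsFormula lP).Sat ν ν')
        (fun ν ν' => (atomsFormula lQ).Sat ν ν')) := by
  intro ν ν'
  have h0 : DGraph.empty.Supported (3 * N) := by intro i j d h; simp [DGraph.empty] at h
  have h1 := DGraph.addAtoms_spec (l := lP) (Nat.zero_le _) h0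
  have h2 := DGraph.addAtoms_spec (l := lQ) le_rfl h1.1
  have h3 := (DGraph.elimMid_spec h2.1).2.2
  -- the unknowns for given values of `x`, `y`, `x'`
  let val (μ : Val N) : ℕ → ℤ := fun i =>
    if i < N then ν (Fin.ofNat N i) else if i < 2 * N then μ (Fin.ofNat N (i - N))
    else ν' (Fin.ofNat N (i - 2 * N))
  have v1 : ∀ μ (i : Fin N), val μ i = ν i := by
    intro μ i; simp [val]
  have v2 : ∀ μ (i : Fin N), val μ (N + i) = μ i := by
    intro μ i
    have : N + (i : ℕ) < 2 * N := by omega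
    simp [val, this]
  have v3 : ∀ μ (i : Fin N), val μ (2 * N + i) = ν' i := by
    intro μ i
    have : ¬ 2 * N + (i : ℕ) < N := by omega
    simp [val, this]
  have hsat := DGraph.sat_toAtoms (composeGraph_supported lP lQ) (val fun _ => 0)
  simp only [v1, v3] at hsat
  have hPQ : ∀ x : ℕ → ℤ, ((DGraph.empty.addAtoms 0 lP).addAtoms N lQ).Sat Set.univ x ↔
      (atomsFormula lP).Sat (fun i => x i) (fun i => x (N + i)) ∧
      (atomsFormula lQ).Sat (fun i => x (N + i)) (fun i => x (2 * N + i)) := by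
    intro x
    have e1 : ∀ v : Var N, Sum.elim (fun i : Fin N => x i) (fun i : Fin N => x (N + i)) v =
        x (idx v + 0) := by rintro (i | i) <;> simp [idx]
    have e2 : ∀ v : Var N, Sum.elim (fun i : Fin N => x (N + i))
        (fun i : Fin N => x (2 * N + i)) v = x (idx v + N) := by
      rintro (i | i) <;> simp only [idx, Sum.elim_inl, Sum.elim_inr] <;> congr 1 <;> omega
    have e3 : DGraph.empty.Sat Set.univ x := ⟨rfl, by simp [DGraph.empty]⟩
    rw [h2.2.2, h1.2.2, sat_atomsFormula, sat_atomsFormula]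
    simp only [e1, e2, e3, true_and]
  rw [hsat, composeGraph, h3]
  constructor
  · rintro ⟨μ, hP, hQ⟩
    refine ⟨val μ, fun i hi => ?_, (hPQ _).2 ?_⟩
    · simp only [DGraph.outer, Set.mem_ofPred_eq] at hi
      simp only [val]
      split_ifs <;> first | rfl | omega
    · simp only [v1, v2, v3]
      exact ⟨hP, hQ⟩
  · rintro ⟨x, hx, hs⟩
    obtain ⟨hP, hQ⟩ := (hPQ x).1 hs
    have e1 : (fun i : Fin N => x i) = ν := by
      ext i
      exact (hx i (by simp only [DGraph.outer, Set.mem_ofPred_eq]; omega)).trans (v1 (fun _ => 0) i)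
    have e3 : (fun i : Fin N => x (2 * N + i)) = ν' := by
      ext i
      exact (hx _ (by simp only [DGraph.outer, Set.mem_ofPred_eq]; omega)).trans (v3 (fun _ => 0) i)
    rw [e1] at hP
    rw [e3] at hQ
    exact ⟨_, hP, hQ⟩

/-! ### Closure under composition and the size of powers -/

theorem eq_atomsFormula_nil_of_mem_DB_zero {φ : QFPA 0} (h : φ ∈ DB 0) : φ = atomsFormula [] := by
  obtain ⟨l, -, rfl⟩ := mem_DB_iff.1 h
  rcases l with _ | ⟨⟨v, -⟩, l⟩
  · rfl
  · exact v.elim Fin.elim0 Fin.elim0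

theorem defines_atomsFormula_nil {N : ℕ} {R : Rel N} :
    (atomsFormula []).Defines R ↔ ∀ ν ν', R ν ν' :=
  forall₂_congr fun _ _ => iff_true_right trivial

theorem eq_of_defines {N : ℕ} {φ : QFPA N} {R : Rel N} (h : φ.Defines R) :
    R = fun ν ν' => φ.Sat ν ν' :=
  funext₂ fun ν ν' => propext (h ν ν')

/-- Composition with a bound on weights and number of the resulting constraints, uniform in the
number of the given ones. -/
theorem exists_atoms_comp {N : ℕ} [NeZero N] {R S : Rel N} {B : ℤ} (hB : 1 ≤ B)
    {lR lS : List (Atom N)} (hR : (atomsFormula lR).Defines R) (hS : (atomsFormula lS).Defines S)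
    (wR : ∀ a ∈ lR, |a.2.2| ≤ B) (wS : ∀ a ∈ lS, |a.2.2| ≤ B) :
    ∃ l : List (Atom N), (∀ a ∈ l, a.1 ≠ a.2.1) ∧ (∀ a ∈ l, |a.2.2| ≤ 2 ^ N * B) ∧
      (atomsFormula l).Defines (Relation.Comp R S) ∧ l.length ≤ (2 * N) * (2 * N) := by
  refine ⟨(composeGraph lR lS).toAtoms N, DGraph.toAtoms_ne (composeGraph_supported _ _),
    DGraph.toAtoms_weight ?_ (composeGraph_weightLE (by omega) wR wS), ?_,
    DGraph.length_toAtoms_le⟩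
  · have : (1 : ℤ) ≤ 2 ^ N := one_le_pow₀ (by norm_num)
    nlinarith
  · rw [eq_of_defines hR, eq_of_defines hS]
    exact sat_toAtoms_composeGraph lR lS

theorem isRelationClass_DB : IsRelationClass DB := by
  rintro N R S ⟨φ, hφ, hR⟩ ⟨ψ, hψ, hS⟩
  rcases N with _ | N
  · rw [eq_atomsFormula_nil_of_mem_DB_zero hφ, defines_atomsFormula_nil] at hR
    rw [eq_atomsFormula_nil_of_mem_DB_zero hψ, defines_atomsFormula_nil] at hS
    exact ⟨_, mem_DB_iff.2 ⟨[], by simp, rfl⟩,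
      defines_atomsFormula_nil.2 fun ν ν' => ⟨ν, hR _ _, hS _ _⟩⟩
  · obtain ⟨lR, -, rfl⟩ := mem_DB_iff.1 hφ
    obtain ⟨lS, -, rfl⟩ := mem_DB_iff.1 hψ
    refine ⟨_, mem_DB_iff.2 ⟨(composeGraph lR lS).toAtoms (N + 1),
      DGraph.toAtoms_ne (composeGraph_supported _ _), rfl⟩, ?_⟩
    rw [eq_of_defines hR, eq_of_defines hS]
    exact sat_toAtoms_composeGraph lR lS

theorem relPow_one {N : ℕ} (R : Rel N) : relPow R 1 = R := by
  ext ν ν'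
  simp [relPow, Relation.Comp]

theorem relPow_add {N : ℕ} (R : Rel N) (m n : ℕ) :
    relPow R (m + n) = Relation.Comp (relPow R m) (relPow R n) := by
  induction n with
  | zero =>
    ext ν ν'
    simp [relPow, Relation.Comp]
  | succ n ih => rw [← add_assoc, relPow, ih, relPow, Relation.comp_assoc]

/-- The weights of the `n`-th power: composing `R^⌈n/2⌉` with `R^⌊n/2⌋` multiplies the bound on
the weights by `2 ^ N` only. -/
theorem exists_atoms_relPow {N : ℕ} [NeZero N] {R : Rel N} {B : ℤ} (hB : 1 ≤ B)
    {l : List (Atom N)} (hl : ∀ a ∈ l, a.1 ≠ a.2.1) (hw : ∀ a ∈ l, |a.2.2| ≤ B)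
    (hR : (atomsFormula l).Defines R) (n : ℕ) (hn : 0 < n) :
    ∃ l' : List (Atom N), (∀ a ∈ l', a.1 ≠ a.2.1) ∧
      (∀ a ∈ l', |a.2.2| ≤ 2 ^ (N * Nat.clog 2 n) * B) ∧
      (atomsFormula l').Defines (relPow R n) ∧ (2 ≤ n → l'.length ≤ (2 * N) * (2 * N)) := by
  induction n using Nat.strong_induction_on with
  | _ n ih =>
    by_cases h2 : 2 ≤ n
    · obtain ⟨l₁, -, w₁, d₁, -⟩ := ih ((n + 1) / 2) (by omega) (by omega)
      obtain ⟨l₂, -, w₂, d₂, -⟩ := ih (n / 2) (by omega) (by omega)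
      have hmono : Nat.clog 2 (n / 2) ≤ Nat.clog 2 ((n + 1) / 2) := Nat.clog_mono_right 2 (by omega)
      have hpow : (1 : ℤ) ≤ 2 ^ (N * Nat.clog 2 ((n + 1) / 2)) := one_le_pow₀ (by norm_num)
      obtain ⟨l', hl', w', d', hlen⟩ := exists_atoms_comp (by nlinarith) d₁ d₂ w₁
        fun a ha => (w₂ a ha).trans (by gcongr; norm_num)
      refine ⟨l', hl', fun a ha => (w' a ha).trans_eq ?_, ?_, fun _ => hlen⟩
      · rw [Nat.clog_of_two_le (by norm_num) h2, mul_add, mul_one, pow_add, ← mul_assoc]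
        simp only [show n + 2 - 1 = n + 1 by omega]
        ring
      · rw [← relPow_add, show (n + 1) / 2 + n / 2 = n by omega] at d'
        exact d'
    · obtain rfl : n = 1 := by omega
      exact ⟨l, hl, by simpa using hw, by rwa [relPow_one], fun h => absurd h h2⟩

theorem binInt_le {c : ℤ} {e : ℕ} (he : 2 ≤ e) (h : |c| ≤ 2 ^ e) : binInt c ≤ e := by
  unfold binInt
  split_ifs
  · refine Nat.clog_le_of_le_pow ?_
    zify
    exact h
  · exact he

theorem two_le_binInt (c : ℤ) : 2 ≤ binInt c := by
  unfold binInt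
  split_ifs with h
  · exact (Nat.lt_clog_iff_pow_lt (b := 2) (y := 1) (by norm_num)).2 (by omega)
  · rfl

theorem abs_le_two_pow_binInt (c : ℤ) : |c| ≤ 2 ^ binInt c := by
  unfold binInt
  split_ifs with h
  · have := Nat.le_pow_clog (b := 2) (by norm_num) c.natAbs
    zify at this
    exact this
  · have : (c.natAbs : ℤ) ≤ 2 := by exact_mod_cast not_lt.1 h
    rw [Int.natCast_natAbs] at this
    linarith

theorem binInt_neg (c : ℤ) : binInt (-c) = binInt c := by simp [binInt]

theorem bin_dbAtom {N : ℕ} (y z : Var N) (α : ℤ) :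
    (dbAtom y z α).bin = binInt α + 4 * N := by
  have hc : ∀ v, binInt ((Pi.single y 1 - Pi.single z 1 : Var N → ℤ) v) = 2 := by
    intro v
    simp only [Pi.sub_apply, Pi.single_apply]
    split_ifs <;> rfl
  simp only [dbAtom, QFPA.bin, LinTerm.bin, hc, binInt_neg]
  simp
  ring

theorem bin_atomsFormula {N : ℕ} (l : List (Atom N)) :
    (atomsFormula l).bin = (l.map fun a => binInt a.2.2 + 4 * N).sum := by
  induction l with
  | nil => rfl
  | cons a l ih =>
    have : (atomsFormula (a :: l)).bin = (dbAtom a.1 a.2.1 a.2.2).bin + (atomsFormula l).bin := rfl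
    rw [this, bin_dbAtom, ih, List.map_cons, List.sum_cons]

theorem bin_atomsFormula_le {N : ℕ} {l : List (Atom N)} {e : ℕ} (he : 2 ≤ e) (hw : ∀ a ∈ l, |a.2.2| ≤ 2 ^ e) :
    (atomsFormula l).bin ≤ l.length * (e + 4 * N) := by
  rw [bin_atomsFormula]
  refine (List.sum_le_card_nsmul _ (e + 4 * N) ?_).trans_eq (by simp)
  intro m hm
  obtain ⟨a, ha, rfl⟩ := List.mem_map.1 hm
  exact Nat.add_le_add_right (binInt_le he (hw a ha)) _

theorem binInt_add_le_bin {N : ℕ} {l : List (Atom N)} {a : Atom N} (ha : a ∈ l) : binInt a.2.2 + 4 * N ≤ (atomsFormula l).bin := by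
  rw [bin_atomsFormula]
  exact List.single_le_sum (by simp) _ (List.mem_map.2 ⟨a, ha, rfl⟩)

theorem relBin_le {N : ℕ} {R : Rel N} {l : List (Atom N)} (hl : ∀ a ∈ l, a.1 ≠ a.2.1)
    (h : (atomsFormula l).Defines R) : relBin DB R ≤ (atomsFormula l).bin :=
  Nat.sInf_le ⟨_, mem_DB_iff.2 ⟨l, hl, rfl⟩, h, rfl⟩

theorem exists_atoms_relBin {N : ℕ} {R : Rel N} (h : Definable DB R) :
    ∃ l : List (Atom N), (∀ a ∈ l, a.1 ≠ a.2.1) ∧ (atomsFormula l).Defines R ∧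
      (atomsFormula l).bin = relBin DB R := by
  obtain ⟨φ, hφ, hR⟩ := h
  obtain ⟨ψ, hψ, hd, hb⟩ := Nat.sInf_mem (s := {b | ∃ φ ∈ DB N, φ.Defines R ∧ φ.bin = b})
    ⟨_, φ, hφ, hR, rfl⟩
  obtain ⟨l, hl, rfl⟩ := mem_DB_iff.1 hψ
  exact ⟨l, hl, hd, hb⟩

theorem clog_le_two_mul_max (n : ℕ) :
    (Nat.clog 2 n : ℝ) ≤ 2 * max 1 (Real.logb 2 n) := by
  rcases le_or_gt 0 (Real.logb 2 n) with h | h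
  · have h1 := Nat.ceil_lt_add_one h
    have h2 := Real.natCeil_logb_natCast 2 n
    norm_num at h2
    rw [h2] at h1
    linarith [le_max_left 1 (Real.logb 2 n), le_max_right 1 (Real.logb 2 n)]
  · have h2 := Real.natCeil_logb_natCast 2 n
    norm_num at h2
    rw [Nat.ceil_eq_zero.2 h.le] at h2
    rw [← h2, Nat.cast_zero]
    linarith [le_max_left 1 (Real.logb 2 n)]

theorem powerSizeBound_DB : PowerSizeBound DB 3 1 := by
  refine ⟨1, fun N R hR n hn => ?_⟩
  obtain ⟨l, hl, hd, hb⟩ := exists_atoms_relBin hR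
  have hM : (1 : ℝ) ≤ max 1 (Real.logb 2 n) := le_max_left _ _
  set M := max 1 (Real.logb 2 n) with hMdef
  rw [pow_one, one_mul]
  rcases l.eq_nil_or_concat with rfl | ⟨l₀, a, hl₀⟩
  · -- only the empty constraint has size `0`; it defines the full relation, as do its powers
    have htop : relBin DB (relPow R n) = 0 := by
      refine Nat.le_zero.1 (relBin_le (l := []) (by simp) (defines_atomsFormula_nil.2 ?_))
      obtain ⟨n, rfl⟩ := Nat.exists_eq_succ_of_ne_zero hn.ne'
      intro ν ν'
      have hR := defines_atomsFormula_nil.1 hd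
      clear hn hM hMdef
      induction n generalizing ν' with
      | zero => rw [relPow_one]; exact hR _ _
      | succ n ih => exact ⟨ν', ih ν', hR _ _⟩
    rw [htop, Nat.cast_zero]
    positivity
  · have ha : a ∈ l := by simp [hl₀]
    have hbin := binInt_add_le_bin ha
    have h2 := two_le_binInt a.2.2
    have hN : NeZero N := ⟨by rintro rfl; exact a.1.elim Fin.elim0 Fin.elim0⟩
    set b := relBin DB R
    rw [hb] at hbin
    rcases Nat.lt_or_ge 1 n with h1 | h1
    · obtain ⟨l', hl', hw', hd', hlen⟩ := exists_atoms_relPow (B := 2 ^ b)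
        (one_le_pow₀ (by norm_num)) hl (fun a ha => (abs_le_two_pow_binInt _).trans
          (pow_le_pow_right₀ (by norm_num) (by have := binInt_add_le_bin ha; omega))) hd n hn
      have h3 : relBin DB (relPow R n) ≤
          (2 * N) * (2 * N) * (N * Nat.clog 2 n + b + 4 * N) := by
        refine (relBin_le hl' hd').trans ((bin_atomsFormula_le (e := N * Nat.clog 2 n + b)
          (by omega) fun a ha => ?_).trans (Nat.mul_le_mul_right _ (hlen h1)))
        rw [pow_add]
        exact hw' a ha
      have h4 : (4 * N : ℝ) ≤ b := by exact_mod_cast (by omega : 4 * N ≤ b)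
      have h5 := clog_le_two_mul_max n
      rw [← hMdef] at h5
      have h3' : (relBin DB (relPow R n) : ℝ) ≤
          (2 * N) * (2 * N) * (N * Nat.clog 2 n + b + 4 * N) := by exact_mod_cast h3
      have h0 : (0 : ℝ) ≤ N := N.cast_nonneg
      have hb0 : (0 : ℝ) ≤ b := b.cast_nonneg
      calc (relBin DB (relPow R n) : ℝ)
          ≤ (2 * N) * (2 * N) * (N * Nat.clog 2 n + b + 4 * N) := h3'
        _ ≤ (b / 2) * (b / 2) * (b / 4 * (2 * M) + b * M + b * M) := by
            have h6 : (b : ℝ) ≤ b * M := le_mul_of_one_le_right hb0 hM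
            have h7 := h4.trans h6
            have h8 : (2 * N : ℝ) ≤ b / 2 := by linarith
            have h9 : (N : ℝ) ≤ b / 4 := by linarith
            gcongr
        _ = 5 / 8 * (b ^ 3 * M) := by ring
        _ ≤ b ^ 3 * M := by
            have : 0 ≤ (b : ℝ) ^ 3 * M := by positivity
            linarith
    · obtain rfl : n = 1 := by omega
      rw [relPow_one]
      have hb1 : (1 : ℝ) ≤ b := by exact_mod_cast (by omega : 1 ≤ b)
      calc (b : ℝ) ≤ b ^ 3 := le_self_pow₀ hb1 (by norm_num)
        _ ≤ b ^ 3 * M := le_mul_of_one_le_right (by positivity) hM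

/-! ### Time bounds for programs without multiplication -/

/-- Runs of a program in which every assignment and every test counts as one step. -/
inductive Run : Prog → Store → Store → ℕ → Prop where
  | skip (s : Store) : Run .skip s s 1
  | assign (s : Store) (a : ℕ) (i e : Expr) :
      Run (.assign a i e) s (s.write a (i.eval s) (e.eval s)) 1
  | seq {c d : Prog} {s s' s'' : Store} {u u' : ℕ} :
      Run c s s' u → Run d s' s'' u' → Run (.seq c d) s s'' (u + u')
  | ite_pos {e : Expr} {c d : Prog} {s s' : Store} {u : ℕ} :
      0 < e.eval s → Run c s s' u → Run (.ite e c d) s s' (1 + u)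
  | ite_neg {e : Expr} {c d : Prog} {s s' : Store} {u : ℕ} :
      ¬ 0 < e.eval s → Run d s s' u → Run (.ite e c d) s s' (1 + u)
  | loop_exit {e : Expr} {c : Prog} {s : Store} :
      ¬ 0 < e.eval s → Run (.loop e c) s s 1
  | loop_step {e : Expr} {c : Prog} {s s' s'' : Store} {u u' : ℕ} :
      0 < e.eval s → Run c s s' u → Run (.loop e c) s' s'' u' →
        Run (.loop e c) s s'' (1 + u + u')

/-- The expression contains no multiplication. -/
def Expr.NoMul : Expr → Prop
  | .lit _ => True
  | .get _ i => i.NoMul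
  | .add e f => e.NoMul ∧ f.NoMul
  | .sub e f => e.NoMul ∧ f.NoMul
  | .mul _ _ => False

/-- A size of expressions that bounds both their growth and, up to a factor, their cost. -/
def Expr.weight : Expr → ℕ
  | .lit c => c.natAbs + 1
  | .get _ i => i.weight + 1
  | .add e f => e.weight + f.weight + 1
  | .sub e f => e.weight + f.weight + 1
  | .mul e f => e.weight + f.weight + 1

/-- The program contains no multiplication. -/
def Prog.NoMul : Prog → Prop
  | .skip => True
  | .assign _ i e => i.NoMul ∧ e.NoMul
  | .seq c d => c.NoMul ∧ d.NoMul
  | .ite e c d => e.NoMul ∧ c.NoMul ∧ d.NoMul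
  | .loop e c => e.NoMul ∧ c.NoMul

/-- A bound on the weights of the expressions of a program. -/
def Prog.weight : Prog → ℕ
  | .skip => 0
  | .assign _ i e => i.weight + e.weight
  | .seq c d => c.weight + d.weight
  | .ite e c d => e.weight + c.weight + d.weight
  | .loop e c => e.weight + c.weight

/-- All cells of the store are at most `2 ^ L` in absolute value. -/
def Store.BitsLE (s : Store) (L : ℕ) : Prop := ∀ a i, |s a i| ≤ 2 ^ L

theorem len_le {z : ℤ} {m : ℕ} (h : |z| ≤ 2 ^ m) : len z ≤ m + 2 := by
  unfold len
  have : z.natAbs < 2 ^ (m + 1) := by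
    zify
    have : (0 : ℤ) < 2 ^ m := by positivity
    rw [pow_succ]
    linarith
  have := Nat.size_le.2 this
  omega

theorem Expr.abs_eval_le {s : Store} {L : ℕ} (hs : s.BitsLE L) {e : Expr} (he : e.NoMul) :
    |e.eval s| ≤ 2 ^ (L + e.weight) := by
  have hsum : ∀ {e f : Expr}, |e.eval s| ≤ 2 ^ (L + e.weight) → |f.eval s| ≤ 2 ^ (L + f.weight) →
      |e.eval s| + |f.eval s| ≤ 2 ^ (L + (e.weight + f.weight + 1)) := by
    intro e f h1 h2
    have h3 : (2 : ℤ) ^ (L + e.weight) ≤ 2 ^ (L + (e.weight + f.weight)) :=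
      pow_le_pow_right₀ (by norm_num) (by omega)
    have h4 : (2 : ℤ) ^ (L + f.weight) ≤ 2 ^ (L + (e.weight + f.weight)) :=
      pow_le_pow_right₀ (by norm_num) (by omega)
    rw [← add_assoc, pow_succ]
    linarith
  induction e with
  | lit c =>
    have h1 : |c| ≤ 2 ^ c.natAbs := by
      rw [← Int.natCast_natAbs]
      exact_mod_cast Nat.lt_two_pow_self.le
    exact h1.trans (pow_le_pow_right₀ (by norm_num) (by simp only [weight]; omega))
  | get a i ih => exact (hs a _).trans (pow_le_pow_right₀ (by norm_num) (by omega))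
  | add e f ihe ihf => exact (abs_add_le _ _).trans (hsum (ihe he.1) (ihf he.2))
  | sub e f ihe ihf => exact (abs_sub _ _).trans (hsum (ihe he.1) (ihf he.2))
  | mul e f => exact he.elim

theorem Expr.len_eval_le {s : Store} {L : ℕ} (hs : s.BitsLE L) {e : Expr} (he : e.NoMul) :
    len (e.eval s) ≤ L + e.weight + 2 := len_le (abs_eval_le hs he)

theorem Expr.cost_le {s : Store} {L : ℕ} (hs : s.BitsLE L) {e : Expr} (he : e.NoMul) :
    e.cost s ≤ 3 * e.weight * (L + e.weight + 2) := by
  have hsum : ∀ {e f : Expr}, e.NoMul → f.NoMul → e.cost s ≤ 3 * e.weight * (L + e.weight + 2) →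
      f.cost s ≤ 3 * f.weight * (L + f.weight + 2) →
      e.cost s + f.cost s + len (e.eval s) + len (f.eval s) ≤
        3 * (e.weight + f.weight + 1) * (L + (e.weight + f.weight + 1) + 2) := by
    intro e f he hf h1 h2
    have h3 := len_eval_le hs he
    have h4 := len_eval_le hs hf
    nlinarith
  induction e with
  | lit c =>
    have h1 := len_eval_le hs he
    exact h1.trans (Nat.le_mul_of_pos_left _ (by simp only [weight]; omega))
  | get a i ih =>
    have h1 := ih he
    have h2 := len_eval_le (e := i) hs he
    have h3 := len_le (hs a (i.eval s))
    simp only [cost, weight]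
    nlinarith
  | add e f ihe ihf => exact hsum he.1 he.2 (ihe he.1) (ihf he.2)
  | sub e f ihe ihf => exact hsum he.1 he.2 (ihe he.1) (ihf he.2)
  | mul e f => exact he.elim

theorem Store.BitsLE.mono {s : Store} {L L' : ℕ} (hs : s.BitsLE L) (h : L ≤ L') : s.BitsLE L' :=
  fun a i => (hs a i).trans (pow_le_pow_right₀ (by norm_num) h)

theorem Store.BitsLE.write {s : Store} {L : ℕ} (hs : s.BitsLE L) {a : ℕ} {i z : ℤ}
    (hz : |z| ≤ 2 ^ L) : (s.write a i z).BitsLE L := by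
  intro b j
  unfold Store.write
  by_cases hb : b = a
  · subst hb
    rw [Function.update_self]
    by_cases hj : j = i
    · subst hj; rwa [Function.update_self]
    · rw [Function.update_of_ne hj]; exact hs _ _
  · rw [Function.update_of_ne hb]; exact hs _ _

/-- Without multiplication, every step lengthens the integers in the store by a constant number
of bits only, so that the bit cost is polynomial in the number of steps and the initial length. -/
theorem Run.exists_exec {c : Prog} {s s' : Store} {u : ℕ} (h : Run c s s' u) {K : ℕ}
    (hc : c.NoMul) (hK : c.weight ≤ K) {L : ℕ} (hs : s.BitsLE L) :
    s'.BitsLE (L + K * u) ∧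
      ∃ t, Exec c s s' t ∧ t ≤ u * (5 * (K + 1) * (L + K * u + K + 2)) := by
  -- the cost of a test and of an assignment
  have test : ∀ {e : Expr} {s : Store} {L M : ℕ}, s.BitsLE L → e.NoMul → e.weight ≤ K →
      L + K + 2 ≤ M → e.cost s + len (e.eval s) ≤ 5 * (K + 1) * M := by
    intro e s L M hs he hK hM
    have h1 := e.cost_le hs he
    have h2 := e.len_eval_le hs he
    have h3 : 3 * e.weight * (L + e.weight + 2) ≤ 3 * K * M := by gcongr; omega
    nlinarith
  induction h generalizing L with
  | skip s => exact ⟨hs.mono (by omega), 1, .skip s, by nlinarith⟩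
  | assign s a i e =>
    simp only [Prog.weight] at hK
    refine ⟨(hs.mono (by omega)).write ((e.abs_eval_le hs hc.2).trans
      (pow_le_pow_right₀ (by norm_num) (by omega))), _, .assign s a i e, ?_⟩
    have h1 := i.cost_le hs hc.1
    have h2 := i.len_eval_le hs hc.1
    have h3 := e.cost_le hs hc.2
    have h4 := e.len_eval_le hs hc.2
    have h5 : 3 * i.weight * (L + i.weight + 2) ≤ 3 * i.weight * (L + K * 1 + K + 2) :=
      Nat.mul_le_mul_left _ (by omega)
    have h6 : 3 * e.weight * (L + e.weight + 2) ≤ 3 * e.weight * (L + K * 1 + K + 2) :=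
      Nat.mul_le_mul_left _ (by omega)
    have h7 : 3 * (i.weight + e.weight) * (L + K * 1 + K + 2) ≤ 3 * K * (L + K * 1 + K + 2) := by
      gcongr
    nlinarith
  | @seq c d s s' s'' u u' _ _ ih1 ih2 =>
    simp only [Prog.weight] at hK
    obtain ⟨b1, t1, e1, ht1⟩ := ih1 hc.1 (by omega) hs
    obtain ⟨b2, t2, e2, ht2⟩ := ih2 hc.2 (by omega) b1
    refine ⟨b2.mono (by rw [mul_add, add_assoc]), _, .seq e1 e2, ?_⟩
    have h1 : u * (5 * (K + 1) * (L + K * u + K + 2)) ≤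
        u * (5 * (K + 1) * (L + K * (u + u') + K + 2)) := by
      gcongr; omega
    have h2 : L + K * u + K * u' = L + K * (u + u') := by ring
    rw [h2] at ht2
    linarith
  | @ite_pos e c d s s' u he _ ih =>
    simp only [Prog.weight] at hK
    obtain ⟨b, t, e1, ht⟩ := ih hc.2.1 (by omega) hs
    refine ⟨b.mono (by rw [mul_add]; omega), _, .ite_pos he e1, ?_⟩
    have h1 : u * (5 * (K + 1) * (L + K * u + K + 2)) ≤
        u * (5 * (K + 1) * (L + K * (1 + u) + K + 2)) := by
      gcongr; omega
    have h2 := test (M := L + K * (1 + u) + K + 2) hs hc.1 (by omega) (by omega)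
    linarith
  | @ite_neg e c d s s' u he _ ih =>
    simp only [Prog.weight] at hK
    obtain ⟨b, t, e1, ht⟩ := ih hc.2.2 (by omega) hs
    refine ⟨b.mono (by rw [mul_add]; omega), _, .ite_neg he e1, ?_⟩
    have h1 : u * (5 * (K + 1) * (L + K * u + K + 2)) ≤
        u * (5 * (K + 1) * (L + K * (1 + u) + K + 2)) := by
      gcongr; omega
    have h2 := test (M := L + K * (1 + u) + K + 2) hs hc.1 (by omega) (by omega)
    linarith
  | @loop_exit e c s he =>
    simp only [Prog.weight] at hK
    refine ⟨hs.mono (by omega), _, Exec.loop_stop he, ?_⟩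
    have h2 := test (M := L + K * 1 + K + 2) hs hc.1 (by omega) (by omega)
    linarith
  | @loop_step e c s s' s'' u u' he _ _ ih1 ih2 =>
    have hK' := hK
    simp only [Prog.weight] at hK
    obtain ⟨b1, t1, e1, ht1⟩ := ih1 hc.2 (by omega) hs
    obtain ⟨b2, t2, e2, ht2⟩ := ih2 hc hK' b1
    refine ⟨b2.mono (by rw [mul_add, mul_add]; omega), _, .loop_step he e1 e2, ?_⟩
    have h1 : u * (5 * (K + 1) * (L + K * u + K + 2)) ≤
        u * (5 * (K + 1) * (L + K * (1 + u + u') + K + 2)) := by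
      gcongr; omega
    have h3 : u' * (5 * (K + 1) * (L + K * u + K * u' + K + 2)) ≤
        u' * (5 * (K + 1) * (L + K * (1 + u + u') + K + 2)) := by
      exact Nat.mul_le_mul_left _ (Nat.mul_le_mul_left _ (by rw [mul_add, mul_add]; omega))
    have h2 := test (M := L + K * (1 + u + u') + K + 2) hs hc.1 (by omega) (by omega)
    linarith

/-! ### Total correctness with a step count -/

/-- The program `c`, started in `s`, halts after at most `n` steps in a store satisfying `Q`. -/
def WP (c : Prog) (n : ℕ) (s : Store) (Q : Store → Prop) : Prop :=
  ∃ s' u, Run c s s' u ∧ u ≤ n ∧ Q s'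

/-- The arrays to which a program assigns. -/
def Prog.writes : Prog → List ℕ
  | .skip => []
  | .assign a _ _ => [a]
  | .seq c d => c.writes ++ d.writes
  | .ite _ c d => c.writes ++ d.writes
  | .loop _ c => c.writes

@[simp] theorem Store.write_of_ne {s : Store} {a b : ℕ} {i z : ℤ} (h : b ≠ a) :
    s.write a i z b = s b := Function.update_of_ne h _ _

@[simp] theorem Store.write_self {s : Store} {a : ℕ} {i z : ℤ} :
    s.write a i z a = Function.update (s a) i z := Function.update_self _ _ _

theorem Run.frame {c : Prog} {s s' : Store} {u : ℕ} (h : Run c s s' u) :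
    ∀ a ∉ c.writes, s' a = s a := by
  induction h with
  | skip => exact fun _ _ => rfl
  | assign s b i e =>
    intro a ha
    exact Store.write_of_ne (by simpa [Prog.writes] using ha)
  | seq _ _ ih1 ih2 =>
    intro a ha
    simp only [Prog.writes, List.mem_append, not_or] at ha
    rw [ih2 a ha.2, ih1 a ha.1]
  | ite_pos _ _ ih =>
    intro a ha
    simp only [Prog.writes, List.mem_append, not_or] at ha
    exact ih a ha.1
  | ite_neg _ _ ih =>
    intro a ha
    simp only [Prog.writes, List.mem_append, not_or] at ha
    exact ih a ha.2
  | loop_exit => exact fun _ _ => rfl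
  | loop_step _ _ _ ih1 ih2 =>
    intro a ha
    rw [ih2 a ha, ih1 a ha]

namespace WP

variable {c d : Prog} {n m : ℕ} {s : Store} {Q Q' : Store → Prop} {e : Expr}

theorem mono (h : WP c n s Q) (hn : n ≤ m) (hQ : ∀ s', Q s' → Q' s') : WP c m s Q' := by
  obtain ⟨s', u, h1, h2, h3⟩ := h
  exact ⟨s', u, h1, h2.trans hn, hQ _ h3⟩

theorem imp (h : WP c n s Q) (hQ : ∀ s', Q s' → Q' s') : WP c n s Q' := h.mono le_rfl hQ

theorem frame (h : WP c n s Q) : WP c n s fun s' => Q s' ∧ ∀ a ∉ c.writes, s' a = s a := by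
  obtain ⟨s', u, h1, h2, h3⟩ := h
  exact ⟨s', u, h1, h2, h3, h1.frame⟩

theorem skip (h : Q s) : WP .skip 1 s Q := ⟨s, 1, .skip s, le_rfl, h⟩

theorem assign {a : ℕ} {i : Expr} (h : Q (s.write a (i.eval s) (e.eval s))) :
    WP (.assign a i e) 1 s Q := ⟨_, 1, .assign s a i e, le_rfl, h⟩

theorem seq (h : WP c n s fun s' => WP d m s' Q) : WP (.seq c d) (n + m) s Q := by
  obtain ⟨s', u, h1, h2, s'', u', h3, h4, h5⟩ := h
  exact ⟨s'', _, .seq h1 h3, Nat.add_le_add h2 h4, h5⟩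

theorem ite (h1 : 0 < e.eval s → WP c n s Q) (h2 : ¬ 0 < e.eval s → WP d n s Q) :
    WP (.ite e c d) (1 + n) s Q := by
  by_cases h : 0 < e.eval s
  · obtain ⟨s', u, h3, h4, h5⟩ := h1 h
    exact ⟨s', _, .ite_pos h h3, by omega, h5⟩
  · obtain ⟨s', u, h3, h4, h5⟩ := h2 h
    exact ⟨s', _, .ite_neg h h3, by omega, h5⟩

theorem loop_exit (h : ¬ 0 < e.eval s) (hQ : Q s) : WP (.loop e c) 1 s Q :=
  ⟨s, 1, .loop_exit h, le_rfl, hQ⟩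

theorem loop_step (h : 0 < e.eval s) (hc : WP c n s fun s' => WP (.loop e c) m s' Q) :
    WP (.loop e c) (1 + n + m) s Q := by
  obtain ⟨s', u, h1, h2, s'', u', h3, h4, h5⟩ := hc
  exact ⟨s'', _, .loop_step h h1 h3, by omega, h5⟩

end WP

/-- The variable kept in cell `0` of array `a`. -/
abbrev Expr.var (a : ℕ) : Expr := .get a (.lit 0)

/-- `a := e` for the variable `a`. -/
abbrev Prog.set (a : ℕ) (e : Expr) : Prog := .assign a (.lit 0) e

/-- `for v from 0 to b - 1 do c`. -/
def Prog.for (v : ℕ) (b : Expr) (c : Prog) : Prog :=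
  .seq (.set v (.lit 0)) (.loop (.sub b (.var v)) (.seq c (.set v (.add (.var v) (.lit 1)))))

/-- The rule for `for` loops.  Arrays other than those written by the body and the loop variable
keep their initial contents, so that the invariant `I` need not mention them. -/
theorem WP.for {c : Prog} {m v n : ℕ} {b : Expr} {s : Store} (I : ℕ → Store → Prop)
    (hv : v ∉ c.writes)
    (hb : ∀ s', (∀ a ∉ v :: c.writes, s' a = s a) → b.eval s' = n)
    (hI : ∀ k < n, ∀ s', I k s' → s' v 0 = k → (∀ a ∉ v :: c.writes, s' a = s a) →
      WP c m s' fun s'' => I (k + 1) (s''.write v 0 ((k + 1 : ℕ) : ℤ)))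
    (h0 : I 0 (s.write v 0 0)) :
    WP (.for v b c) (n * (m + 2) + 2) s fun s' => I n s' ∧ ∀ a ∉ v :: c.writes, s' a = s a := by
  suffices ∀ j ≤ n, ∀ s', I (n - j) s' → s' v 0 = (n - j : ℕ) →
      (∀ a ∉ v :: c.writes, s' a = s a) →
      WP (.loop (.sub b (.var v)) (.seq c (.set v (.add (.var v) (.lit 1)))))
        (j * (m + 2) + 1) s' fun s' => I n s' ∧ ∀ a ∉ v :: c.writes, s' a = s a by
    refine (WP.seq (n := 1) (WP.assign
      (this n le_rfl _ (by simpa [Expr.eval] using h0) (by simp [Expr.eval]) fun a ha => ?_))).mono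
      (by omega) fun _ h => h
    rw [Store.write_of_ne (List.ne_of_not_mem_cons ha)]
  intro j
  induction j with
  | zero =>
    intro _ s' h1 h2 h3
    refine (WP.loop_exit ?_ ⟨h1, h3⟩).mono (by omega) fun _ h => h
    simp [Expr.eval, hb s' h3, h2]
  | succ j ih =>
    intro hj s' h1 h2 h3
    refine (WP.loop_step (n := m + 1) (m := j * (m + 2) + 1) ?_ (WP.seq
      ((hI _ (by omega) s' h1 h2 h3).frame.imp ?_))).mono
      (by rw [Nat.add_mul]; omega) fun _ h => h
    · simp only [Expr.eval, hb s' h3, h2]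
      omega
    · rintro s'' ⟨h4, h5⟩
      have h6 : s'' v 0 = (n - (j + 1) : ℕ) := by rw [h5 v hv, h2]
      have h7 : n - (j + 1) + 1 = n - j := by omega
      rw [h7] at h4
      have h8 : s'' v 0 + 1 = (n - j : ℕ) := by omega
      refine WP.assign (ih (by omega) _ ?_ ?_ fun a ha => ?_)
      · simpa only [Expr.eval, h8] using h4
      · simp [Expr.eval, h8]
      · rw [Store.write_of_ne (List.ne_of_not_mem_cons ha),
          h5 a (List.not_mem_of_not_mem_cons ha), h3 a ha]

/-! ### A program for the composition -/

/-! Array `0` is used for the output, arrays `1, 2` hold the input formulae, and arrays `6, 7, 8` hold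
the multiples of `3N`, the weights, and the flags of present edges.  The other arrays serve as
variables: `3, 4, 5, 18` for the constants `N, 2N, 3N, 2N + 3`, `9` for the flag of a contradiction,
`10` and `17` for the positions in input and output, `11, 12, 13` for the arguments of `relaxProg`,
`14, 15, 16` for loops, and `19, 20, 21` for vertices. -/

open DiffBounds.Expr DiffBounds.Prog

/-- Address of the entry `(i, j)` of a matrix with `3N` columns, array `6` holding the
multiples of `3N`. -/
abbrev cell (i j : Expr) : Expr := .add (.get 6 i) j

/-- For `y ≠ z`, set the entry `(y, z)` to `min(entry, c)`, with `y, z, c` in the variables `11, 12, 13`; array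
`7` holds the weights, and array `8` is positive where an edge is present. -/
def updateProg : Prog :=
  .ite (.get 8 (cell (var 11) (var 12)))
    (.ite (.sub (.get 7 (cell (var 11) (var 12))) (var 13))
      (.assign 7 (cell (var 11) (var 12)) (var 13)) .skip)
    (.seq (.assign 7 (cell (var 11) (var 12)) (var 13))
      (.assign 8 (cell (var 11) (var 12)) (.lit 1)))

/-- `DGraph.relax`; the variable `9` is positive if a contradiction has been found. -/
def relaxProg : Prog :=
  .ite (.sub (var 11) (var 12)) updateProg
    (.ite (.sub (var 12) (var 11)) updateProg
      (.ite (.sub (.lit 0) (var 13)) (.set 9 (.lit 1)) .skip))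

/-- `DGraph.relaxVia`, with `k, i, j` in the variables `19, 14, 15`. -/
def relaxViaProg : Prog :=
  .ite (.get 8 (cell (var 14) (var 19)))
    (.ite (.get 8 (cell (var 19) (var 15)))
      (.seq (.set 11 (var 14)) (.seq (.set 12 (var 15))
        (.seq (.set 13 (.add (.get 7 (cell (var 14) (var 19))) (.get 7 (cell (var 19) (var 15)))))
          relaxProg))) .skip) .skip

/-- `DGraph.elimMid`; the variables `3, 5` hold `N, 3N`. -/
def elimProg : Prog :=
  .for 16 (var 3) (.seq (.set 19 (.add (var 3) (var 16)))
    (.for 14 (var 5) (.for 15 (var 5) relaxViaProg)))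

/-- Find the positions of the coefficients `1` and `-1` of the atomic proposition at position
`10` of array `a`. -/
def scanProg (a : ℕ) (off : Expr) : Prog :=
  .for 14 (var 4)
    (.seq (.ite (.get a (.add (.add (var 10) (.lit 3)) (var 14)))
        (.set 11 (.add (var 14) off)) .skip)
      (.ite (.sub (.lit 0) (.get a (.add (.add (var 10) (.lit 3)) (var 14))))
        (.set 12 (.add (var 14) off)) .skip))

/-- `DGraph.addAtoms`, for the formula in array `a`: a conjunct starts with the tag `4`, and the
formula ends with the tag `0`. -/
def parseLoop (a : ℕ) (off : Expr) : Prog :=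
  .loop (.get a (var 10)) (.seq (scanProg a off)
    (.seq (.set 13 (.sub (.lit 0) (.get a (.add (var 10) (.lit 2)))))
      (.seq relaxProg (.set 10 (.add (var 10) (var 18))))))

/-- Append the atomic proposition `y - z ≤ c` to the output, with the positions of `y, z` in the
variables `14, 15` and `c` in the variable `13`; `17` is the current end of the output. -/
def emitProg : Prog :=
  .seq (.assign 0 (var 17) (.lit 4)) (.seq (.assign 0 (.add (var 17) (.lit 1)) (.lit 1))
    (.seq (.assign 0 (.add (var 17) (.lit 2)) (.sub (.lit 0) (var 13)))
      (.seq (.assign 0 (.add (.add (var 17) (.lit 3)) (var 14)) (.lit 1))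
        (.seq (.assign 0 (.add (.add (var 17) (.lit 3)) (var 15)) (.lit (-1)))
          (.set 17 (.add (var 17) (var 18)))))))

/-- `b := vtx N a`. -/
def vtxProg (a b : ℕ) : Prog :=
  .ite (.sub (var 3) (var a)) (.set b (var a)) (.set b (.add (var a) (var 3)))

/-- `DGraph.atomAt`. -/
def emitEdgeProg : Prog :=
  .seq (vtxProg 14 20) (.seq (vtxProg 15 21)
    (.ite (.get 8 (cell (var 20) (var 21)))
      (.seq (.set 13 (.get 7 (cell (var 20) (var 21)))) emitProg) .skip))

/-- `DGraph.toAtoms`. -/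
def outputProg : Prog :=
  .ite (var 9)
    (.seq (.set 14 (.lit 0)) (.seq (.set 15 (var 3)) (.seq (.set 13 (.lit (-1))) (.seq emitProg
      (.seq (.set 14 (var 3)) (.seq (.set 15 (.lit 0)) emitProg))))))
    (.for 14 (var 4) (.for 15 (var 4) emitEdgeProg))

/-- Compute `N`, `2N`, `3N`, the length `2N + 3` of the code of an atomic proposition with its
tag, and the multiples of `3N`; clear the output. -/
def initProg : Prog :=
  .seq (.set 3 (.get 0 (.lit 1))) (.seq (.set 4 (.add (var 3) (var 3)))
    (.seq (.set 5 (.add (var 4) (var 3))) (.seq (.set 18 (.add (var 4) (.lit 3)))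
      (.seq (.for 14 (var 5) (.assign 6 (.add (var 14) (.lit 1)) (.add (.get 6 (var 14)) (var 5))))
        (.seq (.assign 0 (.lit 1) (.lit 0)) (.set 17 (.lit 1)))))))

/-- The composition of two constraints, not both empty. -/
def composeProg : Prog :=
  .seq initProg (.seq (.set 10 (.lit 1)) (.seq (parseLoop 1 (.lit 0)) (.seq (.set 10 (.lit 1))
    (.seq (parseLoop 2 (var 3)) (.seq elimProg (.seq outputProg (.set 0 (var 17))))))))

/-! ### Correctness of the elimination -/

/-- The constants computed by `initProg`. -/
structure Params (N : ℕ) (s : Store) : Prop where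
  one : s 3 0 = N
  two : s 4 0 = 2 * N
  three : s 5 0 = 3 * N
  stride : s 18 0 = 2 * N + 3
  table : ∀ i : ℕ, i < 3 * N → s 6 i = i * (3 * N)

theorem Params.congr {N : ℕ} {s s' : Store} (h : Params N s)
    (hs : ∀ a ∈ [3, 4, 5, 6, 18], s' a = s a) : Params N s' := by
  constructor
  · rw [hs 3 (by decide), h.one]
  · rw [hs 4 (by decide), h.two]
  · rw [hs 5 (by decide), h.three]
  · rw [hs 18 (by decide), h.stride]
  · rw [hs 6 (by decide)]; exact h.table

/-- The system represented by a store. -/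
def graph (N : ℕ) (s : Store) : DGraph where
  edge i j := if i < 3 * N ∧ j < 3 * N ∧ 0 < s 8 (i * (3 * N) + j) then
    some (s 7 (i * (3 * N) + j)) else none
  bad := decide (0 < s 9 0)

theorem graph_congr {N : ℕ} {s s' : Store} (h7 : s' 7 = s 7) (h8 : s' 8 = s 8) (h9 : s' 9 = s 9) :
    graph N s' = graph N s := by
  unfold graph
  rw [h7, h8, h9]

@[simp] theorem graph_write {N : ℕ} {s : Store} {a : ℕ} {i z : ℤ} (h : a ≠ 7 ∧ a ≠ 8 ∧ a ≠ 9) :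
    graph N (s.write a i z) = graph N s :=
  graph_congr (Store.write_of_ne h.1.symm) (Store.write_of_ne h.2.1.symm)
    (Store.write_of_ne h.2.2.symm)

theorem cell_injective {W i j y z : ℕ} (hj : j < W) (hz : z < W)
    (h : (i * W + j : ℤ) = y * W + z) : i = y ∧ j = z := by
  have h' : i * W + j = y * W + z := by exact_mod_cast h
  have h1 : (i * W + j) / W = i := by
    rw [mul_comm, Nat.mul_add_div (by omega), Nat.div_eq_of_lt hj, add_zero]
  have h2 : (y * W + z) / W = y := by
    rw [mul_comm, Nat.mul_add_div (by omega), Nat.div_eq_of_lt hz, add_zero]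
  have h3 : i = y := by rw [← h1, h', h2]
  subst h3
  exact ⟨rfl, by omega⟩

/-- The effect of `updateProg` on the arrays `7, 8` amounts to `DGraph.relax`. -/
theorem graph_eq_relax {N : ℕ} {s s' : Store} {y z : ℕ} {c : ℤ} (hy : y < 3 * N) (hz : z < 3 * N)
    (hyz : y ≠ z) (h9 : s' 9 = s 9)
    (h7 : ∀ a : ℤ, a ≠ y * (3 * N) + z → s' 7 a = s 7 a)
    (h8 : ∀ a : ℤ, a ≠ y * (3 * N) + z → s' 8 a = s 8 a)
    (hF : 0 < s' 8 (y * (3 * N) + z))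
    (hD : s' 7 (y * (3 * N) + z) =
      if 0 < s 8 (y * (3 * N) + z) then min (s 7 (y * (3 * N) + z)) c else c) :
    graph N s' = (graph N s).relax y z c := by
  unfold DGraph.relax
  rw [if_neg hyz]
  ext1
  · funext i j
    dsimp only [graph]
    by_cases h : i = y ∧ j = z
    · obtain ⟨rfl, rfl⟩ := h
      simp only [hy, hz, hF, hD, true_and, and_self, if_true]
      split_ifs <;> rfl
    · rw [if_neg h]
      by_cases hb : i < 3 * N ∧ j < 3 * N
      · have hne : (i * (3 * N) + j : ℤ) ≠ y * (3 * N) + z := by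
          intro he
          exact h (cell_injective (W := 3 * N) hb.2 hz (by push_cast; exact he))
        rw [h7 _ hne, h8 _ hne]
      · rw [if_neg (by tauto), if_neg (by tauto)]
  · simp only [graph, h9]

theorem wp_updateProg {N : ℕ} {s : Store} (hp : Params N s) {y z : ℕ} {c : ℤ} (hy : y < 3 * N)
    (hz : z < 3 * N) (hyz : y ≠ z) (h11 : s 11 0 = y) (h12 : s 12 0 = z) (h13 : s 13 0 = c) :
    WP updateProg 4 s fun s' => graph N s' = (graph N s).relax y z c := by
  have hc : (cell (var 11) (var 12)).eval s = y * (3 * N) + z := by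
    simp [Expr.eval, h11, h12, hp.table y hy]
  have hv : (var 13).eval s = c := h13
  have he : ∀ a, (Expr.get a (cell (var 11) (var 12))).eval s = s a (y * (3 * N) + z) := by
    intro a; rw [Expr.eval, hc]
  refine (WP.ite (n := 2) (fun h1 => ?_) (fun h1 => ?_)).mono (by norm_num) fun _ h => h
  · rw [he] at h1
    refine (WP.ite (n := 1) (fun h2 => WP.assign ?_) (fun h2 => WP.skip ?_))
    · rw [Expr.eval, he, hv] at h2
      rw [hc, hv]
      refine graph_eq_relax hy hz hyz (by simp) (fun a ha => ?_) (fun a ha => ?_) ?_ ?_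
      · simp [ha]
      · simp
      · simpa using h1
      · simp only [Store.write_self, Function.update_self, h1, if_true]
        rw [min_eq_right (by linarith)]
    · rw [Expr.eval, he, hv] at h2
      refine graph_eq_relax hy hz hyz rfl (fun _ _ => rfl) (fun _ _ => rfl) h1 ?_
      rw [if_pos h1, min_eq_left (by linarith)]
  · rw [he] at h1
    refine WP.seq (n := 1) (m := 1) (WP.assign (WP.assign ?_))
    have hc' : (cell (var 11) (var 12)).eval (s.write 7 (y * (3 * N) + z) c) =
        y * (3 * N) + z := by
      simp [Expr.eval, h11, h12, hp.table y hy]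
    rw [hc, hv, hc']
    refine graph_eq_relax hy hz hyz (by simp) (fun a ha => ?_) (fun a ha => ?_) ?_ ?_
    · simp [ha]
    · simp [ha]
    · simp [Expr.eval]
    · simp [h1]

theorem wp_relaxProg {N : ℕ} {s : Store} (hp : Params N s) {y z : ℕ} {c : ℤ} (hy : y < 3 * N)
    (hz : z < 3 * N) (h11 : s 11 0 = y) (h12 : s 12 0 = z) (h13 : s 13 0 = c) :
    WP relaxProg 6 s fun s' => graph N s' = (graph N s).relax y z c := by
  refine (WP.ite (n := 5) (fun h1 => ?_) (fun h1 => ?_)).mono (by norm_num) fun _ h => h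
  · simp only [Expr.eval, h11, h12] at h1
    exact (wp_updateProg hp hy hz (by omega) h11 h12 h13).mono (by norm_num) fun _ h => h
  refine (WP.ite (n := 4) (fun h2 => ?_) (fun h2 => ?_)).mono (by norm_num) fun _ h => h
  · simp only [Expr.eval, h11, h12] at h2
    exact wp_updateProg hp hy hz (by omega) h11 h12 h13
  simp only [Expr.eval, h11, h12] at h1 h2
  obtain rfl : y = z := by omega
  refine (WP.ite (n := 1) (fun h3 => WP.assign ?_) (fun h3 => WP.skip ?_)).mono (by norm_num)
    fun _ h => h <;> simp only [Expr.eval, h13] at h3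
  · have : c < 0 := by linarith
    unfold DGraph.relax
    ext1 <;> simp [graph, Expr.eval, this]
  · have : ¬ c < 0 := by linarith
    unfold DGraph.relax
    ext1 <;> simp [graph, this]

theorem wp_relaxViaProg {N : ℕ} {s : Store} (hp : Params N s) {k i j : ℕ} (hk : k < 3 * N)
    (hi : i < 3 * N) (hj : j < 3 * N) (h19 : s 19 0 = k) (h14 : s 14 0 = i) (h15 : s 15 0 = j) :
    WP relaxViaProg 11 s fun s' => graph N s' = (graph N s).relaxVia k i j := by
  have e1 : ∀ a, (Expr.get a (cell (var 14) (var 19))).eval s = s a (i * (3 * N) + k) := by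
    intro a; simp [Expr.eval, h14, h19, hp.table i hi]
  have e2 : ∀ a, (Expr.get a (cell (var 19) (var 15))).eval s = s a (k * (3 * N) + j) := by
    intro a; simp [Expr.eval, h15, h19, hp.table k hk]
  unfold DGraph.relaxVia
  refine (WP.ite (n := 10) (fun h1 => ?_) (fun h1 => WP.mono (n := 1) (WP.skip ?_) (by norm_num)
    fun _ h => h)) <;> rw [e1] at h1
  · refine (WP.ite (n := 9) (fun h2 => ?_) (fun h2 => WP.mono (n := 1) (WP.skip ?_) (by norm_num)
      fun _ h => h)) <;> rw [e2] at h2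
    · refine (WP.seq (n := 1) (m := 8) <| WP.assign <| WP.seq (n := 1) (m := 7) <| WP.assign <|
        WP.seq (n := 1) (m := 6) <| WP.assign ?_)
      refine (wp_relaxProg (y := i) (z := j)
        (c := s 7 (i * (3 * N) + k) + s 7 (k * (3 * N) + j)) (hp.congr ?_) hi hj ?_ ?_ ?_).imp ?_
      · simp
      · simp [Expr.eval, h14]
      · simp [Expr.eval, h15]
      · simp [Expr.eval, h14, h15, h19, hp.table i hi, hp.table k hk]
      · intro s' hs'
        rw [hs']
        simp [graph, hi, hj, hk, h1, h2]
    · simp [graph, hi, hj, hk, h1, h2]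
  · simp [graph, hi, hk, h1]

theorem wp_elimProg {N : ℕ} {s : Store} (hp : Params N s) :
    WP elimProg (N * (1 + (3 * N * (3 * N * (11 + 2) + 2 + 2) + 2) + 2) + 2) s
      fun s' => graph N s' = (graph N s).elimMid N := by
  refine (WP.for (fun m s' => graph N s' =
    iter (fun m G => G.elim (3 * N) (N + m)) m (graph N s)) (by decide)
    (fun s' hs' => ?_) (fun m hm s1 h1 hv1 f1 => ?_) ?_).imp fun _ h => h.1
  · rw [Expr.eval, hs' 3 (by decide)]; exact hp.one
  · refine WP.seq (WP.assign ?_)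
    have p1 := hp.congr (s' := s1) fun a ha => f1 a (by revert a; decide)
    set s2 := s1.write 19 ((Expr.lit 0).eval s1) ((Expr.add (var 3) (var 16)).eval s1) with hs2
    have p2 : Params N s2 := p1.congr (by simp [hs2])
    have hk : s2 19 0 = (N + m : ℕ) := by simp [hs2, Expr.eval, p1.one, hv1]
    have g2 : graph N s2 = graph N s1 := by simp [hs2]
    refine (WP.for (n := 3 * N) (fun i s' => graph N s' = iter (fun i G =>
      iter (fun j G => G.relaxVia (N + m) i j) (3 * N) G) i (graph N s1)) (by decide)
      (fun s' hs' => ?_) (fun i hi s3 h3 hv3 f3 => ?_) ?_).imp ?_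
    · rw [Expr.eval, hs' 5 (by decide)]; simpa [Expr.eval] using p2.three
    · have p3 := p2.congr (s' := s3) fun a ha => f3 a (by revert a; decide)
      refine (WP.for (n := 3 * N) (fun j s' => graph N s' =
        iter (fun j G => G.relaxVia (N + m) i j) j (graph N s3)) (by decide)
        (fun s' hs' => ?_) (fun j hj s4 h4 hv4 f4 => ?_) ?_).imp ?_
      · rw [Expr.eval, hs' 5 (by decide)]; simpa [Expr.eval] using p3.three
      · have p4 := p3.congr (s' := s4) fun a ha => f4 a (by revert a; decide)
        refine (wp_relaxViaProg p4 (k := N + m) (by omega) hi hj ?_ ?_ hv4).imp ?_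
        · rw [f4 19 (by decide), f3 19 (by decide), hk]
        · rw [f4 14 (by decide), hv3]
        · intro s' hs'
          rw [graph_write (by decide), hs', h4]
          rfl
      · rw [graph_write (by decide)]; rfl
      · rintro s' ⟨hs', -⟩
        rw [graph_write (by decide), hs', h3]
        rfl
    · rw [graph_write (by decide), g2]; rfl
    · rintro s' ⟨hs', -⟩
      rw [graph_write (by decide), hs', h1]
      rfl
  · rw [graph_write (by decide)]; rfl

/-! ### Codes of formulae -/

/-- The code of an atomic proposition, preceded by the tag of a conjunction. -/
def atomCode {N : ℕ} (a : Atom N) : List ℤ := 4 :: (dbAtom a.1 a.2.1 a.2.2).code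

theorem code_atomsFormula_cons {N : ℕ} (a : Atom N) (l : List (Atom N)) :
    (atomsFormula (a :: l)).code = atomCode a ++ (atomsFormula l).code := rfl

theorem code_atomsFormula {N : ℕ} (l : List (Atom N)) :
    (atomsFormula l).code = l.flatMap atomCode ++ [0] := by
  induction l with
  | nil => rfl
  | cons a l ih => rw [code_atomsFormula_cons, ih, List.flatMap_cons, List.append_assoc]

theorem length_atomCode {N : ℕ} (a : Atom N) : (atomCode a).length = 2 * N + 3 := by
  simp [atomCode, dbAtom, QFPA.code, LinTerm.code]
  ring

theorem length_flatMap_atomCode {N : ℕ} (l : List (Atom N)) :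
    (l.flatMap atomCode).length = l.length * (2 * N + 3) := by
  simp [List.length_flatMap, length_atomCode]

theorem getD_coeffs {N : ℕ} (f : Var N → ℤ) (v : Var N) :
    (List.ofFn (fun i => f (Sum.inl i)) ++ List.ofFn (fun i => f (Sum.inr i))).getD (idx v) 0 =
      f v := by
  rcases v with i | i
  · rw [List.getD_append _ _ _ _ (by simp [idx])]
    simp [idx]
  · rw [List.getD_append_right _ _ _ _ (by simp [idx])]
    simp [idx]

theorem getD_atomCode {N : ℕ} (a : Atom N) (v : Var N) :
    (atomCode a).getD (3 + idx v) 0 =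
      (if v = a.1 then 1 else 0) - (if v = a.2.1 then 1 else 0) := by
  rw [show 3 + idx v = idx v + 1 + 1 + 1 by ring]
  simp only [atomCode, dbAtom, QFPA.code, LinTerm.code, List.getD_cons_succ]
  rw [getD_coeffs]
  simp [Pi.single_apply]

theorem exists_idx_eq {N v : ℕ} (hv : v < 2 * N) : ∃ w : Var N, idx w = v := by
  have : NeZero N := ⟨by omega⟩
  exact ⟨varAt N v, idx_varAt hv⟩

/-! ### Correctness of parsing and output -/

/-- The list `l` is stored in array `a` from position `p` on, followed by zeros. -/
def Stored (s : Store) (a p : ℕ) (l : List ℤ) : Prop :=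
  ∀ m : ℕ, s a ((p : ℤ) + m) = l.getD m 0

theorem wp_scanProg {N : ℕ} {s : Store} (hp : Params N s) {a : ℕ} (ha : a = 1 ∨ a = 2)
    {off : Expr} {o : ℕ} (hoff : ∀ s' : Store, s' 3 = s 3 → off.eval s' = o) {p : ℕ}
    (h10 : s 10 0 = p) {b : Atom N} (hne : b.1 ≠ b.2.1) {l : List ℤ}
    (hs : Stored s a p (atomCode b ++ l)) :
    WP (scanProg a off) (2 * N * (4 + 2) + 2) s fun s' =>
      s' 11 0 = (idx b.1 + o : ℕ) ∧ s' 12 0 = (idx b.2.1 + o : ℕ) := by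
  refine (WP.for (n := 2 * N) (fun k s' =>
    (idx b.1 < k → s' 11 0 = (idx b.1 + o : ℕ)) ∧ (idx b.2.1 < k → s' 12 0 = (idx b.2.1 + o : ℕ)))
    ?_ (fun s' hs' => ?_) (fun k hk s1 h1 hv1 f1 => ?_) (by simp)).imp
    fun _ h => ⟨h.1.1 (idx_lt _), h.1.2 (idx_lt _)⟩
  · simp [Prog.writes]
  · simp only [Prog.writes] at hs'
    simpa [Expr.eval, hs' 4 (by simp)] using hp.two
  · simp only [Prog.writes] at f1
    have f : ∀ a' ∉ [14, 11, 12], s1 a' = s a' := fun a' ha' => f1 a' (by simpa using ha')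
    have hf : ∀ s2 : Store, s2 3 = s1 3 → off.eval s2 = o :=
      fun s2 h => hoff s2 (h.trans (f 3 (by decide)))
    obtain ⟨v, rfl⟩ := exists_idx_eq hk
    -- the coefficient of the variable `v`
    have hcoef : ∀ s2 : Store, s2 10 = s1 10 → s2 14 = s1 14 → s2 a = s1 a →
        (Expr.get a (.add (.add (var 10) (.lit 3)) (var 14))).eval s2 =
          (if v = b.1 then 1 else 0) - (if v = b.2.1 then 1 else 0) := by
      intro s2 e10 e14 ea
      have := hs (3 + idx v)
      rw [List.getD_append _ _ _ _ (by rw [length_atomCode]; omega), getD_atomCode] at this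
      rw [← this]
      simp only [Expr.eval, e10, e14, ea, hv1, f 10 (by decide), h10,
        f a (by rcases ha with rfl | rfl <;> decide)]
      congr 1
      push_cast
      ring
    have hval : ∀ s2 : Store, s2 3 = s1 3 → s2 14 = s1 14 →
        (Expr.add (var 14) off).eval s2 = (idx v + o : ℕ) := by
      intro s2 e3 e14
      simp [Expr.eval, e14, hv1, hf s2 e3]
    have hidx : ∀ w : Var N, idx w < idx v + 1 ↔ w = v ∨ idx w < idx v := by
      intro w
      rw [Nat.lt_succ_iff_lt_or_eq, idx_injective.eq_iff, or_comm]
    have hlt : ∀ w : Var N, w = v → ¬ idx w < idx v := by rintro w rfl; exact lt_irrefl _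
    refine WP.seq (n := 2) (m := 2) ?_
    -- after the first test, the variable `11` is right
    suffices ∀ s2 : Store, (∀ a' ≠ 11, s2 a' = s1 a') →
        (idx b.1 < idx v + 1 → s2 11 0 = (idx b.1 + o : ℕ)) →
        WP (.ite (.sub (.lit 0) (.get a (.add (.add (var 10) (.lit 3)) (var 14))))
          (.set 12 (.add (var 14) off)) .skip) 2 s2 fun s' =>
          (idx b.1 < idx v + 1 → s'.write 14 0 ((idx v + 1 : ℕ) : ℤ) 11 0 = (idx b.1 + o : ℕ)) ∧
          (idx b.2.1 < idx v + 1 →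
            s'.write 14 0 ((idx v + 1 : ℕ) : ℤ) 12 0 = (idx b.2.1 + o : ℕ)) by
      refine WP.ite (n := 1) (fun h => WP.assign (this _ (fun a' ha' => ?_) fun _ => ?_))
        (fun h => WP.skip (this _ (fun _ _ => rfl) fun hv => ?_))
      · exact Store.write_of_ne ha'
      · rw [hcoef _ rfl rfl rfl] at h
        have : v = b.1 := by
          by_contra hc
          rw [if_neg hc] at h
          split_ifs at h <;> omega
        rw [hval _ rfl rfl, this]
        simp [Expr.eval]
      · rw [hcoef _ rfl rfl rfl] at h
        rcases (hidx _).1 hv with hv | hv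
        · rw [if_pos hv.symm, if_neg (by rw [← hv]; exact hne)] at h
          omega
        · exact h1.1 hv
    intro s2 f2 h2
    have ha11 : a ≠ 11 := by rcases ha with rfl | rfl <;> decide
    have hc2 := hcoef s2 (f2 10 (by decide)) (f2 14 (by decide)) (f2 a ha11)
    refine WP.ite (n := 1) (fun h => WP.assign ⟨fun hv => ?_, fun _ => ?_⟩)
      (fun h => WP.skip ⟨fun hv => ?_, fun hv => ?_⟩)
    · simpa using h2 hv
    · rw [Expr.eval, hc2] at h
      have : v = b.2.1 := by
        by_contra hc
        rw [if_neg hc] at h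
        simp only [Expr.eval] at h
        split_ifs at h <;> omega
      rw [hval _ (f2 3 (by decide)) (f2 14 (by decide)), this]
      simp [Expr.eval]
    · simpa using h2 hv
    · rw [Expr.eval, hc2] at h
      rcases (hidx _).1 hv with hv | hv
      · rw [if_pos hv.symm, if_neg (by rw [← hv]; exact hne.symm)] at h
        simp [Expr.eval] at h
      · simpa [f2 12 (by decide)] using h1.2 hv

theorem wp_parseLoop {N : ℕ} {a : ℕ} (ha : a = 1 ∨ a = 2) {off : Expr} {o : ℕ} (ho : o ≤ N)
    {l : List (Atom N)} (hl : ∀ b ∈ l, b.1 ≠ b.2.1) {s : Store} (hp : Params N s)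
    (hoff : ∀ s' : Store, s' 3 = s 3 → off.eval s' = o) {p : ℕ} (h10 : s 10 0 = p)
    (hs : Stored s a p (atomsFormula l).code) :
    WP (parseLoop a off) (l.length * (2 * N * (4 + 2) + 11) + 1) s
      fun s' => graph N s' = (graph N s).addAtoms o l := by
  induction l generalizing s p with
  | nil =>
    refine WP.mono (n := 1) (Q := fun s' => graph N s' = (graph N s).addAtoms o [])
      (WP.loop_exit ?_ rfl) (by omega) fun _ h => h
    have := hs 0
    simp only [Expr.eval, h10]
    simp [atomsFormula, conj, QFPA.code] at this
    simp [this]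
  | cons b l ih =>
    rw [List.forall_mem_cons] at hl
    rw [code_atomsFormula_cons] at hs
    refine (WP.loop_step (n := (2 * N * (4 + 2) + 2) + (1 + (6 + 1)))
      (m := l.length * (2 * N * (4 + 2) + 11) + 1) ?_
      (WP.seq ((wp_scanProg hp ha hoff h10 hl.1 hs).frame.imp ?_))).mono
      (by rw [List.length_cons, Nat.add_mul]; omega) fun _ h => h
    · have := hs 0
      simp [atomCode] at this
      simp [Expr.eval, h10, this]
    rintro s1 ⟨⟨h11, h12⟩, f1⟩
    have f1 : ∀ a' ∉ [14, 11, 12], s1 a' = s a' := by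
      intro a' ha'
      simp only [List.mem_cons, List.not_mem_nil, or_false, not_or] at ha'
      exact f1 a' (by simp [scanProg, Prog.for, Prog.writes]; tauto)
    have hsa : ∀ s' : Store, s' a = s a → s' 10 = s 10 →
        (Expr.sub (.lit 0) (.get a (.add (var 10) (.lit 2)))).eval s' = b.2.2 := by
      intro s' e1 e2
      have h := hs 2
      rw [List.getD_append _ _ _ _ (by rw [length_atomCode]; omega)] at h
      simp [atomCode, dbAtom, QFPA.code, LinTerm.code] at h
      simp [Expr.eval, e1, e2, h10, h]
    refine WP.seq (WP.assign ?_)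
    rw [hsa s1 (f1 a (by rcases ha with rfl | rfl <;> decide)) (f1 10 (by decide))]
    set s2 := s1.write 13 ((Expr.lit 0).eval s1) b.2.2 with hs2
    have f2 : ∀ a' ∉ [14, 11, 12, 13], s2 a' = s a' := by
      intro a' ha'
      simp only [List.mem_cons, List.not_mem_nil, or_false, not_or] at ha'
      rw [hs2, Store.write_of_ne (by tauto), f1 a' (by simp; tauto)]
    have p2 : Params N s2 := hp.congr fun a' ha' => f2 a' (by revert a'; decide)
    have i1 := idx_lt b.1
    have i2 := idx_lt b.2.1
    refine WP.seq ((wp_relaxProg p2 (y := idx b.1 + o) (z := idx b.2.1 + o) (c := b.2.2)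
      (by omega) (by omega) (by simpa [hs2] using h11) (by simpa [hs2] using h12)
      (by simp [hs2, Expr.eval])).frame.imp ?_)
    rintro s3 ⟨g3, f3⟩
    have f3 : ∀ a' ∉ [14, 11, 12, 13, 7, 8, 9], s3 a' = s a' := by
      intro a' ha'
      simp only [List.mem_cons, List.not_mem_nil, or_false, not_or] at ha'
      rw [f3 a' (by simp [relaxProg, updateProg, Prog.writes]; tauto), f2 a' (by simp; tauto)]
    refine WP.assign ?_
    have e10 : (Expr.add (var 10) (var 18)).eval s3 = (p + (2 * N + 3) : ℕ) := by
      simp [Expr.eval, f3 10 (by decide), f3 18 (by decide), h10, hp.stride]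
    rw [e10]
    refine (ih hl.2 (p := p + (2 * N + 3)) (s := s3.write 10 ((Expr.lit 0).eval s3)
      (p + (2 * N + 3) : ℕ)) ?_ ?_ ?_ ?_).imp ?_
    · exact hp.congr fun a' ha' => by
        rw [Store.write_of_ne (by rintro rfl; revert ha'; decide), f3 a' (by revert a'; decide)]
    · intro s' hs'
      refine hoff s' (hs'.trans ?_)
      rw [Store.write_of_ne (by decide), f3 3 (by decide)]
    · simp [Expr.eval]
    · intro m
      rw [Store.write_of_ne (by rcases ha with rfl | rfl <;> decide),
        f3 a (by rcases ha with rfl | rfl <;> decide)]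
      have := hs (2 * N + 3 + m)
      rw [List.getD_append_right _ _ _ _ (by rw [length_atomCode]; omega), length_atomCode,
        Nat.add_sub_cancel_left] at this
      rw [← this]
      congr 1
      push_cast
      ring
    · intro s' hs'
      rw [hs', graph_write (by decide), g3]
      have : graph N s2 = graph N s := graph_congr (f2 7 (by decide)) (f2 8 (by decide))
        (f2 9 (by decide))
      rw [this]
      rfl

/-- The atomic propositions `l` have been written to the output. -/
def Output {N : ℕ} (s : Store) (l : List (Atom N)) : Prop :=
  s 17 0 = (1 + l.length * (2 * N + 3) : ℕ) ∧ Stored s 0 1 (atomsFormula l).code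

theorem Output.congr {N : ℕ} {s s' : Store} {l : List (Atom N)} (h : Output s l)
    (h0 : s' 0 = s 0) (h17 : s' 17 = s 17) : Output s' l := by
  unfold Output Stored
  rw [h0, h17]
  exact h

/-- The final tag `0` is invisible among the zeros that follow the output, so that the code of the
current conjunction is always present. -/
theorem getD_append_zero (l : List ℤ) (m : ℕ) : (l ++ [0]).getD m 0 = l.getD m 0 := by
  rcases lt_or_ge m l.length with h | h
  · rw [List.getD_append _ _ _ _ h]
  · rw [List.getD_append_right _ _ _ _ h, List.getD_eq_default _ _ h]
    rcases Nat.eq_zero_or_pos (m - l.length) with h' | h'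
    · rw [h']; rfl
    · rw [List.getD_eq_default _ _ (by rw [List.length_singleton]; exact h')]

theorem wp_emitProg {N : ℕ} [NeZero N] {s : Store} (hp : Params N s) {l : List (Atom N)}
    (ho : Output s l) {i j : ℕ} {c : ℤ} (hi : i < 2 * N) (hj : j < 2 * N) (hij : i ≠ j)
    (h14 : s 14 0 = i) (h15 : s 15 0 = j) (h13 : s 13 0 = c) :
    WP emitProg 6 s fun s' => Output s' (l ++ [(varAt N i, varAt N j, c)]) := by
  obtain ⟨h17, hst⟩ := ho
  refine WP.seq (n := 1) (m := 5) <| WP.assign <| WP.seq (n := 1) (m := 4) <| WP.assign <|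
    WP.seq (n := 1) (m := 3) <| WP.assign <| WP.seq (n := 1) (m := 2) <| WP.assign <|
    WP.seq (n := 1) (m := 1) <| WP.assign <| WP.assign ?_
  simp only [Expr.eval, ne_eq, OfNat.ofNat_ne_zero, not_false_eq_true, Store.write_of_ne, h17,
    h14, h15, h13, hp.stride]
  constructor
  · simp
    ring
  · intro m
    rw [Store.write_of_ne (by decide)]
    simp only [Store.write_self]
    have old := hst m
    rw [code_atomsFormula, getD_append_zero] at old
    rw [code_atomsFormula, getD_append_zero, List.flatMap_append, List.flatMap_singleton]
    have hlen := length_flatMap_atomCode l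
    simp only [Function.update_apply]
    rcases lt_or_ge m (l.length * (2 * N + 3)) with h | h
    · rw [List.getD_append _ _ _ _ (by omega), ← old]
      push_cast
      have : (m : ℤ) < l.length * (2 * N + 3) := by exact_mod_cast h
      rw [if_neg (by omega), if_neg (by omega), if_neg (by omega), if_neg (by omega),
        if_neg (by omega)]
    · rw [List.getD_append_right _ _ _ _ (by omega), hlen]
      rw [List.getD_eq_default _ _ (by omega)] at old
      obtain ⟨r, rfl⟩ := Nat.exists_eq_add_of_le h
      rw [Nat.add_sub_cancel_left]
      push_cast at old ⊢
      rw [old]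
      match r with
      | 0 =>
        simp only [atomCode, List.getD_cons_zero, Nat.cast_zero]
        rw [if_neg (by omega), if_neg (by omega), if_neg (by omega), if_neg (by omega),
          if_pos (by omega)]
      | 1 =>
        simp only [atomCode, dbAtom, QFPA.code, List.getD_cons_succ, List.getD_cons_zero]
        rw [if_neg (by omega), if_neg (by omega), if_neg (by omega), if_pos (by omega)]
      | 2 =>
        simp only [atomCode, dbAtom, QFPA.code, LinTerm.code, List.getD_cons_succ,
          List.getD_cons_zero]
        rw [if_neg (by omega), if_neg (by omega), if_pos (by omega)]
        ring
      | r + 3 =>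
        rcases lt_or_ge r (2 * N) with hr | hr
        · obtain ⟨v, rfl⟩ := exists_idx_eq hr
          have hv : ∀ k < 2 * N, v = varAt N k ↔ idx v = k := by
            intro k hk
            rw [← idx_injective.eq_iff, idx_varAt hk]
          rw [add_comm (idx v) 3, getD_atomCode]
          simp only [hv i hi, hv j hj]
          by_cases hvi : idx v = i
          · rw [if_neg (by omega), if_pos (by omega), if_pos hvi, if_neg (by omega)]
            rfl
          · by_cases hvj : idx v = j
            · rw [if_pos (by omega), if_neg hvi, if_pos hvj]
              rfl
            · rw [if_neg (by omega), if_neg (by omega), if_neg (by omega), if_neg (by omega),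
                if_neg (by omega), if_neg hvi, if_neg hvj]
              rfl
        · rw [List.getD_eq_default _ _ (by rw [length_atomCode]; omega)]
          rw [if_neg (by omega), if_neg (by omega), if_neg (by omega), if_neg (by omega),
            if_neg (by omega)]

theorem wp_vtxProg {N : ℕ} {s : Store} (h3 : s 3 0 = N) {a b i : ℕ} (ha : s a 0 = i) :
    WP (vtxProg a b) 2 s fun s' => s' b 0 = vtx N i := by
  unfold vtx
  refine WP.ite (n := 1) (fun h => WP.assign ?_) (fun h => WP.assign ?_) <;>
    simp only [Expr.eval, h3, ha] at h
  · rw [if_pos (by omega)]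
    simp [Expr.eval, ha]
  · rw [if_neg (by omega)]
    simp [Expr.eval, ha, h3]

theorem vtx_lt {N i : ℕ} (hi : i < 2 * N) : vtx N i < 3 * N := by
  unfold vtx
  split_ifs <;> omega

theorem wp_emitEdgeProg {N : ℕ} [NeZero N] {s : Store} (hp : Params N s)
    (hG : (graph N s).Supported (3 * N)) {l : List (Atom N)} (ho : Output s l) {i j : ℕ}
    (hi : i < 2 * N) (hj : j < 2 * N) (h14 : s 14 0 = i) (h15 : s 15 0 = j) :
    WP emitEdgeProg 12 s fun s' => Output s' (l ++ (graph N s).atomAt N i j) := by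
  refine WP.seq (n := 2) (m := 10) ((wp_vtxProg hp.one h14).frame.imp ?_)
  rintro s1 ⟨h20, f1⟩
  refine WP.seq (n := 2) (m := 8) ((wp_vtxProg (N := N) (i := j) ?_ ?_).frame.imp ?_)
  · rw [f1 3 (by decide), hp.one]
  · rw [f1 15 (by decide), h15]
  rintro s2 ⟨h21, f2⟩
  have f : ∀ a ∉ [20, 21], s2 a = s a := by
    intro a ha
    simp only [List.mem_cons, List.not_mem_nil, or_false, not_or] at ha
    rw [f2 a (by simp [vtxProg, Prog.writes]; tauto), f1 a (by simp [vtxProg, Prog.writes]; tauto)]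
  have p2 : Params N s2 := hp.congr fun a ha => f a (by revert a; decide)
  have e20 : s2 20 0 = vtx N i := by rw [f2 20 (by decide), h20]
  have he : ∀ a, (Expr.get a (cell (var 20) (var 21))).eval s2 =
      s2 a (vtx N i * (3 * N) + vtx N j) := by
    intro a
    simp [Expr.eval, e20, h21, p2.table _ (vtx_lt hi)]
  have ho2 : Output s2 l := ho.congr (f 0 (by decide)) (f 17 (by decide))
  have hg : graph N s2 = graph N s :=
    graph_congr (f 7 (by decide)) (f 8 (by decide)) (f 9 (by decide))
  rw [← hg] at hG ⊢
  refine (WP.ite (n := 7) (fun h => ?_) (fun h => ?_)) <;> rw [he] at h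
  · have hedge : (graph N s2).edge (vtx N i) (vtx N j) =
        some (s2 7 (vtx N i * (3 * N) + vtx N j)) := by
      simp [graph, vtx_lt hi, vtx_lt hj, h]
    have hij : i ≠ j := by
      rintro rfl
      exact (hG _ _ _ hedge).2.2 rfl
    refine WP.seq (n := 1) (m := 6) (WP.assign ((wp_emitProg
      (c := s2 7 (vtx N i * (3 * N) + vtx N j)) (p2.congr ?_) (ho2.congr ?_ ?_) hi hj hij ?_ ?_ ?_).imp ?_))
    · simp
    · simp
    · simp
    · simpa [f 14 (by decide)] using h14
    · simpa [f 15 (by decide)] using h15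
    · rw [he]; simp [Expr.eval]
    · intro s' hs'
      unfold DGraph.atomAt
      rw [hedge]
      exact hs'
  · refine (WP.skip ?_).mono (by norm_num) fun _ h => h
    have hedge : (graph N s2).edge (vtx N i) (vtx N j) = none := by
      simp [graph, vtx_lt hi, vtx_lt hj, h]
    unfold DGraph.atomAt
    rw [hedge]
    simpa using ho2

theorem wp_outputProg {N : ℕ} [NeZero N] {s : Store} (hp : Params N s)
    (hG : (graph N s).Supported (3 * N)) (ho : Output (N := N) s []) :
    WP outputProg (1 + (2 * N * (2 * N * (12 + 2) + 2 + 2) + 18)) s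
      fun s' => Output s' ((graph N s).toAtoms N) := by
  have hN := NeZero.pos N
  unfold DGraph.toAtoms
  refine WP.ite (fun h => ?_) (fun h => ?_)
  · have hb : (graph N s).bad = true := by simpa [graph, Expr.eval] using h
    rw [if_pos hb]
    refine WP.mono (n := 18) ?_ (by omega) fun _ h => h
    refine WP.seq (n := 1) (m := 17) <| WP.assign <| WP.seq (n := 1) (m := 16) <| WP.assign <|
      WP.seq (n := 1) (m := 15) <| WP.assign <| WP.seq (n := 6) (m := 9) <|
      (wp_emitProg (N := N) (l := []) (i := 0) (j := N) (c := -1) (hp.congr ?_) (ho.congr ?_ ?_)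
      (by omega) (by omega) (by omega) ?_ ?_ ?_).frame.imp ?_
    · simp
    · simp
    · simp
    · simp [Expr.eval]
    · simp [Expr.eval, hp.one]
    · simp [Expr.eval]
    rintro s1 ⟨ho1, f1⟩
    have p1 : Params N s1 := hp.congr fun a ha => by
      rw [f1 a (by revert a; decide)]
      fin_cases ha <;> simp
    have h13 : s1 13 0 = -1 := by
      rw [f1 13 (by decide)]; simp [Expr.eval]
    refine WP.mono (n := 8) (WP.seq (n := 1) (m := 7) <| WP.assign <| WP.seq (n := 1) (m := 6) <|
      WP.assign <| wp_emitProg (i := N) (j := 0) (c := -1) (p1.congr ?_) (ho1.congr ?_ ?_)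
      (by omega) (by omega) (by omega) ?_ ?_ ?_) (by norm_num) fun _ h => h
    · simp
    · simp
    · simp
    · simp [Expr.eval, p1.one]
    · simp [Expr.eval]
    · simpa using h13
  · have hb : ¬ (graph N s).bad = true := by simpa [graph, Expr.eval] using h
    rw [if_neg hb]
    refine WP.mono (n := 2 * N * (2 * N * (12 + 2) + 2 + 2) + 2) ((WP.for (n := 2 * N)
      (fun n s' => Output s' ((List.range n).flatMap fun i =>
        (List.range (2 * N)).flatMap fun j => (graph N s).atomAt N i j)) (by decide)
      (fun s' hs' => ?_) (fun i hi s1 h1 hv1 f1 => ?_) ?_).imp fun _ h => h.1)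
      (by omega) fun _ h => h
    · simpa [Expr.eval, hs' 4 (by decide)] using hp.two
    · have p1 : Params N s1 := hp.congr fun a ha => f1 a (by revert a; decide)
      set l₀ := (List.range i).flatMap fun i =>
        (List.range (2 * N)).flatMap fun j => (graph N s).atomAt N i j with hl₀
      refine (WP.for (n := 2 * N) (fun n s' => Output s' (l₀ ++ (List.range n).flatMap fun j =>
        (graph N s).atomAt N i j)) (by decide)
        (fun s' hs' => ?_) (fun j hj s2 h2 hv2 f2 => ?_) ?_).imp ?_
      · simpa [Expr.eval, hs' 4 (by decide)] using p1.two
      · have p2 : Params N s2 := p1.congr fun a ha => f2 a (by revert a; decide)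
        have hg : graph N s2 = graph N s := by
          rw [graph_congr (f2 7 (by decide)) (f2 8 (by decide)) (f2 9 (by decide)),
            graph_congr (f1 7 (by decide)) (f1 8 (by decide)) (f1 9 (by decide))]
        refine (wp_emitEdgeProg p2 (by rwa [hg]) h2 hi hj ?_ hv2).imp fun s' hs' => ?_
        · rw [f2 14 (by decide), hv1]
        · rw [hg, List.append_assoc] at hs'
          rw [List.range_succ, List.flatMap_append, List.flatMap_singleton]
          exact hs'.congr (by simp) (by simp)
      · simpa using h1.congr (by simp) (by simp)
      · rintro s' ⟨hs', -⟩
        rw [List.range_succ, List.flatMap_append, List.flatMap_singleton]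
        exact hs'.congr (by simp) (by simp)
    · exact ho.congr (by simp) (by simp)

/-! ### Correctness of the whole program -/

theorem wp_initProg {N : ℕ} {s : Store} (h1 : s 0 1 = N) (h2 : ∀ m : ℕ, s 0 (2 + m) = 0)
    (h6 : s 6 0 = 0) :
    WP initProg (4 + (3 * N * (1 + 2) + 2) + 2) s fun s' =>
      Params N s' ∧ Output (N := N) s' [] := by
  refine WP.mono (n := 1 + (1 + (1 + (1 + ((3 * N * (1 + 2) + 2) + (1 + 1))))))
    (WP.seq <| WP.assign <| WP.seq <| WP.assign <| WP.seq <| WP.assign <| WP.seq <|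
    WP.assign ?_) (by omega) fun _ h => h
  simp only [Expr.eval]
  set s1 : Store := Store.write _ _ _ _ with hs1
  have e3 : s1 3 0 = N := by simp [hs1, h1]
  have e4 : s1 4 0 = 2 * N := by simp [hs1, h1]; ring
  have e5 : s1 5 0 = 3 * N := by simp [hs1, h1]; ring
  have e18 : s1 18 0 = 2 * N + 3 := by simp [hs1, h1]; ring
  have e0 : s1 0 = s 0 := by simp [hs1]
  have e6 : s1 6 = s 6 := by simp [hs1]
  clear_value s1
  refine WP.seq ((WP.for (n := 3 * N) (fun n s' => ∀ i : ℕ, i ≤ n → s' 6 i = i * (3 * N))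
    (by decide) (fun s' hs' => ?_) (fun n hn s2 hs2 hv2 f2 => WP.assign ?_) ?_).imp ?_)
  · simpa [Expr.eval, hs' 5 (by decide)] using e5
  · intro i hi
    simp only [Expr.eval, hv2, f2 5 (by decide), e5, hs2 n le_rfl]
    rw [Store.write_of_ne (by decide), Store.write_self]
    rcases Nat.lt_or_eq_of_le hi with h | rfl
    · rw [Function.update_of_ne (by omega)]
      exact hs2 i (by omega)
    · push_cast
      rw [Function.update_self]
      ring
  · intro i hi
    obtain rfl : i = 0 := by omega
    simp [e6, h6]
  · rintro s2 ⟨ht, f2⟩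
    refine WP.seq (WP.assign (WP.assign ⟨⟨?_, ?_, ?_, ?_, ?_⟩, ?_, ?_⟩))
    · simpa [f2 3 (by decide)] using e3
    · simpa [f2 4 (by decide)] using e4
    · simpa [f2 5 (by decide)] using e5
    · simpa [f2 18 (by decide)] using e18
    · intro i hi
      simpa using ht i hi.le
    · simp [Expr.eval]
    · rintro (_ | m)
      · simp [Expr.eval, atomsFormula, conj, QFPA.code]
      · have : ((1 : ℕ) : ℤ) + (m + 1 : ℕ) = 2 + m := by push_cast; ring
        rw [this, Store.write_of_ne (by decide), Store.write_self, Expr.eval,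
          Function.update_of_ne (by omega), f2 0 (by decide), e0, h2]
        simp [atomsFormula, conj, QFPA.code]

theorem wp_composeProg {N : ℕ} [NeZero N] {lP lQ : List (Atom N)} (hP : ∀ a ∈ lP, a.1 ≠ a.2.1)
    (hQ : ∀ a ∈ lQ, a.1 ≠ a.2.1) {s : Store} (h1 : s 0 1 = N) (h2 : ∀ m : ℕ, s 0 (2 + m) = 0)
    (h0 : ∀ a ∈ [6, 7, 8, 9], s a = 0) (sP : Stored s 1 1 (atomsFormula lP).code)
    (sQ : Stored s 2 1 (atomsFormula lQ).code) :
    WP composeProg ((4 + (3 * N * (1 + 2) + 2) + 2) + (1 +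
      ((lP.length * (2 * N * (4 + 2) + 11) + 1) + (1 +
      ((lQ.length * (2 * N * (4 + 2) + 11) + 1) +
      ((N * (1 + (3 * N * (3 * N * (11 + 2) + 2 + 2) + 2) + 2) + 2) +
      ((1 + (2 * N * (2 * N * (12 + 2) + 2 + 2) + 18)) + 1))))))) s fun s' =>
      HoldsList (s' 0) (atomsFormula ((composeGraph lP lQ).toAtoms N)).code := by
  refine WP.seq ((wp_initProg h1 h2 (by simp [h0 6])).frame.imp ?_)
  rintro s1 ⟨⟨p1, o1⟩, f1⟩
  have g1 : graph N s1 = DGraph.empty := by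
    rw [graph_congr (f1 7 (by decide)) (f1 8 (by decide)) (f1 9 (by decide))]
    simp [graph, DGraph.empty, h0]
  refine WP.seq (WP.assign (WP.seq ((wp_parseLoop (o := 0) (p := 1) (.inl rfl) (Nat.zero_le _) hP
    (p1.congr ?_) (fun _ _ => rfl) ?_ ?_).frame.imp ?_)))
  · simp
  · simp [Expr.eval]
  · intro m
    rw [Store.write_of_ne (by decide), f1 1 (by decide)]
    exact sP m
  rintro s2 ⟨g2, f2⟩
  rw [graph_write (by decide), g1] at g2
  have f2' : ∀ a ∉ 10 :: (parseLoop 1 (.lit 0)).writes, s2 a = s1 a := by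
    intro a ha
    rw [f2 a (List.not_mem_of_not_mem_cons ha), Store.write_of_ne (List.ne_of_not_mem_cons ha)]
  have p2 : Params N s2 := p1.congr fun a ha => f2' a (by revert a; decide)
  refine WP.seq (WP.assign (WP.seq ((wp_parseLoop (o := N) (p := 1) (.inr rfl) le_rfl hQ
    (p2.congr ?_) (fun s' hs' => ?_) ?_ ?_).frame.imp ?_)))
  · simp
  · simpa [Expr.eval, hs'] using p2.one
  · simp [Expr.eval]
  · intro m
    rw [Store.write_of_ne (by decide), f2' 2 (by decide), f1 2 (by decide)]
    exact sQ m
  rintro s3 ⟨g3, f3⟩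
  rw [graph_write (by decide), g2] at g3
  have f3' : ∀ a ∉ 10 :: (parseLoop 2 (var 3)).writes, s3 a = s2 a := by
    intro a ha
    rw [f3 a (List.not_mem_of_not_mem_cons ha), Store.write_of_ne (List.ne_of_not_mem_cons ha)]
  have p3 : Params N s3 := p2.congr fun a ha => f3' a (by revert a; decide)
  refine WP.seq ((wp_elimProg p3).frame.imp ?_)
  rintro s4 ⟨g4, f4⟩
  have p4 : Params N s4 := p3.congr fun a ha => f4 a (by revert a; decide)
  have hg : graph N s4 = composeGraph lP lQ := by rw [g4, g3]; rfl
  have o4 : Output (N := N) s4 [] := o1.congr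
    (by rw [f4 0 (by decide), f3' 0 (by decide), f2' 0 (by decide)])
    (by rw [f4 17 (by decide), f3' 17 (by decide), f2' 17 (by decide)])
  refine WP.seq ((wp_outputProg p4 (hg ▸ composeGraph_supported lP lQ) o4).imp ?_)
  rintro s5 ⟨h5, h5'⟩
  rw [hg] at h5 h5'
  have hlen : (atomsFormula ((composeGraph lP lQ).toAtoms N)).code.length =
      1 + ((composeGraph lP lQ).toAtoms N).length * (2 * N + 3) := by
    rw [code_atomsFormula, List.length_append, length_flatMap_atomCode, List.length_singleton,
      add_comm]
  refine WP.assign ⟨?_, fun i hi => ?_⟩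
  · rw [hlen]
    simpa [Expr.eval] using h5
  · rw [Store.write_self, Expr.eval, Function.update_of_ne (by omega), add_comm]
    have := h5' i
    rw [List.getD_eq_getElem _ _ hi] at this
    exact this

/-! ### The composition in polynomial time -/

/-- The composition of two constraints.  Two empty constraints, whose codes have length `1`, are
treated separately: `N` is not bounded in terms of their binary size then, and must not be read. -/
def fullProg : Prog :=
  .ite (.sub (.add (var 1) (var 2)) (.lit 2)) composeProg
    (.seq (.set 0 (.lit 1)) (.assign 0 (.lit 1) (.lit 0)))

theorem initStore_natCast_add_one (ls : List (List ℤ)) (a m : ℕ) :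
    initStore ls a (1 + m) = (ls.getD a []).getD m 0 := by
  have h : ((1 : ℤ) + m).toNat = m + 1 := by omega
  simp only [initStore]
  rw [if_pos (by omega), h, List.getD_cons_succ]

theorem initStore_zero (ls : List (List ℤ)) (a : ℕ) :
    initStore ls a 0 = (ls.getD a []).length := rfl

theorem initStore_of_length_le {ls : List (List ℤ)} {a : ℕ} (h : ls.length ≤ a) :
    initStore ls a = 0 := by
  funext i
  simp only [initStore, List.getD_eq_default _ _ h]
  cases i.toNat <;> simp

theorem bitsLE_initStore {ls : List (List ℤ)} {L : ℕ}
    (h : ∀ l ∈ ls, l.length ≤ 2 ^ L ∧ ∀ z ∈ l, |z| ≤ 2 ^ L) : (initStore ls).BitsLE L := by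
  intro a i
  have hl : (ls.getD a []).length ≤ 2 ^ L ∧ ∀ z ∈ ls.getD a [], |z| ≤ 2 ^ L := by
    rcases lt_or_ge a ls.length with ha | ha
    · rw [List.getD_eq_getElem _ _ ha]
      exact h _ (List.getElem_mem ha)
    · rw [List.getD_eq_default _ _ ha]
      simp
  generalize hls : ls.getD a [] = l at hl
  simp only [initStore, hls]
  have h0 : |(0 : ℤ)| ≤ 2 ^ L := by simp
  split_ifs
  · rcases lt_or_ge i.toNat ((l.length : ℤ) :: l).length with hi | hi
    · rw [List.getD_eq_getElem _ _ hi]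
      rcases List.mem_cons.1 (List.getElem_mem hi) with he | he
      · rw [he, Nat.abs_cast]
        exact_mod_cast hl.1
      · exact hl.2 _ he
    · rwa [List.getD_eq_default _ _ hi]
  · exact h0

theorem length_mul_le_bin {N : ℕ} (l : List (Atom N)) :
    l.length * (2 + 4 * N) ≤ (atomsFormula l).bin := by
  rw [bin_atomsFormula]
  refine le_trans (by simp) (List.card_nsmul_le_sum _ (2 + 4 * N) ?_)
  intro m hm
  obtain ⟨a, -, rfl⟩ := List.mem_map.1 hm
  exact Nat.add_le_add_right (two_le_binInt _) _

/-- The initial store consists of integers with `b + O(1)` bits: weights have at most `binInt` bits,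
and everything else is small. -/
theorem abs_le_of_mem_code {N : ℕ} {l : List (Atom N)} {b : ℕ} (hb : (atomsFormula l).bin ≤ b)
    {z : ℤ} (hz : z ∈ (atomsFormula l).code) : |z| ≤ 2 ^ (b + 3) := by
  have h1 : (1 : ℤ) ≤ 2 ^ b := one_le_pow₀ (by norm_num)
  have h8 : (2 : ℤ) ^ (b + 3) = 8 * 2 ^ b := by rw [pow_add]; ring
  rw [code_atomsFormula, List.mem_append, List.mem_flatMap, List.mem_singleton] at hz
  rcases hz with ⟨a, ha, hz⟩ | rfl
  · have hcoef : ∀ v, |(Pi.single a.1 1 - Pi.single a.2.1 1 : Var N → ℤ) v| ≤ 1 := by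
      intro v
      simp only [Pi.sub_apply, Pi.single_apply]
      split_ifs <;> norm_num
    simp only [atomCode, dbAtom, QFPA.code, LinTerm.code, List.mem_cons, List.mem_append,
      List.mem_ofFn] at hz
    rcases hz with rfl | rfl | rfl | ⟨i, rfl⟩ | ⟨i, rfl⟩
    · rw [h8, abs_of_nonneg (by norm_num)]; linarith
    · rw [h8, abs_of_nonneg (by norm_num)]; linarith
    · rw [abs_neg]
      exact (abs_le_two_pow_binInt _).trans (pow_le_pow_right₀ (by norm_num)
        (by have := binInt_add_le_bin ha; omega))
    · exact (hcoef _).trans (by linarith)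
    · exact (hcoef _).trans (by linarith)
  · simp

theorem length_code_le {N : ℕ} [NeZero N] {l : List (Atom N)} {b : ℕ}
    (hb : (atomsFormula l).bin ≤ b) : (atomsFormula l).code.length ≤ 2 ^ (b + 3) := by
  have hN := NeZero.pos N
  have h1 := length_mul_le_bin l
  have h2 : l.length * (2 * N + 3) ≤ l.length * (2 + 4 * N) := Nat.mul_le_mul_left _ (by omega)
  have h3 : b + 3 < 2 ^ (b + 3) := Nat.lt_two_pow_self
  rw [code_atomsFormula, List.length_append, length_flatMap_atomCode, List.length_singleton]
  omega

theorem exists_exec_fullProg_nil (N : ℕ) :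
    ∃ s t, Exec fullProg (initStore [[(N : ℤ)], [0], [0]]) s t ∧ HoldsList (s 0) [0] ∧
      t ≤ 100 := by
  refine ⟨_, _, .ite_neg ?_ (.seq (.assign _ _ _ _) (.assign _ _ _ _)), ⟨?_, ?_⟩, ?_⟩
  · simp [Expr.eval, initStore_zero]
  · simp [Expr.eval]
  · intro i hi
    obtain rfl : i = 0 := by simpa using hi
    simp [Expr.eval]
  · simp only [Expr.eval, Expr.cost, initStore_zero, List.getD_cons_succ, List.getD_cons_zero]
    decide

theorem steps_le {N p q b : ℕ} (hb : 1 ≤ b) (hN : N ≤ b) (hp : p ≤ b) (hq : q ≤ b) :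
    1 + ((4 + (3 * N * (1 + 2) + 2) + 2) + (1 +
      ((p * (2 * N * (4 + 2) + 11) + 1) + (1 + ((q * (2 * N * (4 + 2) + 11) + 1) +
      ((N * (1 + (3 * N * (3 * N * (11 + 2) + 2 + 2) + 2) + 2) + 2) +
      ((1 + (2 * N * (2 * N * (12 + 2) + 2 + 2) + 18)) + 1))))))) ≤ 1000 * b ^ 3 := by
  calc _ ≤ 1 + ((4 + (3 * b * (1 + 2) + 2) + 2) + (1 +
      ((b * (2 * b * (4 + 2) + 11) + 1) + (1 + ((b * (2 * b * (4 + 2) + 11) + 1) +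
      ((b * (1 + (3 * b * (3 * b * (11 + 2) + 2 + 2) + 2) + 2) + 2) +
      ((1 + (2 * b * (2 * b * (12 + 2) + 2 + 2) + 18)) + 1))))))) := by gcongr
    _ ≤ 1000 * b ^ 3 := by
      have h1 : b ≤ b ^ 3 := Nat.le_self_pow (by norm_num) b
      have h2 : b ^ 2 ≤ b ^ 3 := Nat.pow_le_pow_right hb (by norm_num)
      have h3 : 1 ≤ b ^ 3 := Nat.one_le_pow _ _ hb
      ring_nf
      ring_nf at h1 h2 h3
      omega

/-- If one of the constraints is nonempty, then `N` and the lengths of the constraints are at most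
`b`, the program makes `O(b³)` steps, and all integers have `O(b³)` bits. -/
theorem exists_exec_fullProg {N : ℕ} [NeZero N] {lP lQ : List (Atom N)}
    (hP : ∀ a ∈ lP, a.1 ≠ a.2.1) (hQ : ∀ a ∈ lQ, a.1 ≠ a.2.1) (hne : lP ≠ [] ∨ lQ ≠ [])
    {b : ℕ} (hb : b = (atomsFormula lP).bin + (atomsFormula lQ).bin) {K : ℕ}
    (hK : fullProg.weight ≤ K) :
    ∃ s t, Exec fullProg
        (initStore [[(N : ℤ)], (atomsFormula lP).code, (atomsFormula lQ).code]) s t ∧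
      HoldsList (s 0) (atomsFormula ((composeGraph lP lQ).toAtoms N)).code ∧
      t ≤ (5000 * (K + 1) * (6 + 1001 * K)) * b ^ 6 := by
  have hlP := length_mul_le_bin lP
  have hlQ := length_mul_le_bin lQ
  have hN := NeZero.pos N
  have hpos : 0 < lP.length + lQ.length := by
    rcases hne with h | h <;> have := List.length_pos_iff.2 h <;> omega
  have hbN : (lP.length + lQ.length) * (2 + 4 * N) ≤ b := by rw [Nat.add_mul]; omega
  have hN' : 2 + 4 * N ≤ b := (Nat.le_mul_of_pos_left _ hpos).trans hbN
  have hlen : lP.length + lQ.length ≤ b := (Nat.le_mul_of_pos_right _ (by omega)).trans hbN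
  have hbits : (initStore [[(N : ℤ)], (atomsFormula lP).code, (atomsFormula lQ).code]).BitsLE
      (b + 3) := by
    have h3 : b + 3 < 2 ^ (b + 3) := Nat.lt_two_pow_self
    refine bitsLE_initStore ?_
    simp only [List.forall_mem_cons]
    refine ⟨⟨by simp; omega, ?_, by simp⟩, ⟨length_code_le (by omega), fun z hz => ?_⟩,
      ⟨length_code_le (by omega), fun z hz => ?_⟩, by simp⟩
    · rw [Nat.abs_cast]
      exact_mod_cast (by omega : N ≤ 2 ^ (b + 3))
    · exact abs_le_of_mem_code (by omega) hz
    · exact abs_le_of_mem_code (by omega) hz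
  have hwp := WP.ite (e := .sub (.add (var 1) (var 2)) (.lit 2)) (c := composeProg)
    (d := .seq (.set 0 (.lit 1)) (.assign 0 (.lit 1) (.lit 0)))
    (fun _ => wp_composeProg hP hQ
      (s := initStore [[(N : ℤ)], (atomsFormula lP).code, (atomsFormula lQ).code])
      (initStore_natCast_add_one _ _ 0) (fun m => ?_) (fun a ha => ?_)
      (fun m => initStore_natCast_add_one _ _ m) (fun m => initStore_natCast_add_one _ _ m))
    (fun h => ?_)
  · obtain ⟨s', u, hrun, hu, hs'⟩ := hwp
    have hu' := hu.trans (steps_le (b := b) (by omega) (by omega) (by omega) (by omega))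
    have hno : fullProg.NoMul := by
      simp [fullProg, composeProg, initProg, parseLoop, scanProg, elimProg, outputProg,
        emitEdgeProg, emitProg, vtxProg, relaxViaProg, relaxProg, updateProg, Prog.for,
        Prog.NoMul, Expr.NoMul]
    obtain ⟨-, t, hexec, ht⟩ := Run.exists_exec (c := fullProg) hrun hno hK hbits
    refine ⟨s', t, hexec, hs', ht.trans ?_⟩
    have h1 : b ≤ b ^ 3 := Nat.le_self_pow (by norm_num) b
    have h3 : 1 ≤ b ^ 3 := Nat.one_le_pow _ _ (by omega)
    calc u * (5 * (K + 1) * (b + 3 + K * u + K + 2))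
        ≤ (1000 * b ^ 3) * (5 * (K + 1) *
          (b ^ 3 + 3 * b ^ 3 + K * (1000 * b ^ 3) + K * b ^ 3 + 2 * b ^ 3)) := by
          gcongr
          · omega
          · exact Nat.le_mul_of_pos_right _ h3
          · omega
      _ = _ := by ring
  · have := initStore_natCast_add_one
      [[(N : ℤ)], (atomsFormula lP).code, (atomsFormula lQ).code] 0 (m + 1)
    push_cast at this
    rw [show (1 : ℤ) + (m + 1) = 2 + m by ring] at this
    rw [this]
    simp
  · exact initStore_of_length_le (by
      simp only [List.mem_cons, List.not_mem_nil, or_false] at ha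
      simp only [List.length_cons, List.length_nil]
      omega)
  · exfalso
    apply h
    simp only [Expr.eval, initStore_zero, List.getD_cons_succ, List.getD_cons_zero,
      code_atomsFormula, List.length_append, length_flatMap_atomCode, List.length_singleton]
    have : 0 < (lP.length + lQ.length) * (2 * N + 3) := Nat.mul_pos hpos (by omega)
    rw [Nat.add_mul] at this
    omega

theorem compositionTimeBound_DB : CompositionTimeBound DB 6 := by
  refine ⟨fullProg, 5000 * (fullProg.weight + 1) * (6 + 1001 * fullProg.weight) + 100,
    fun N P Q hPmem hQmem => ?_⟩
  obtain ⟨lP, hP, rfl⟩ := mem_DB_iff.1 hPmem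
  obtain ⟨lQ, hQ, rfl⟩ := mem_DB_iff.1 hQmem
  set b := (atomsFormula lP).bin + (atomsFormula lQ).bin with hb
  by_cases hne : lP ≠ [] ∨ lQ ≠ []
  · have hN : NeZero N := by
      refine ⟨?_⟩
      rintro rfl
      rcases hne with h | h <;> obtain ⟨a, -⟩ := List.exists_mem_of_ne_nil _ h <;>
        exact a.1.elim Fin.elim0 Fin.elim0
    obtain ⟨s, t, h1, h2, h3⟩ := exists_exec_fullProg hP hQ hne hb le_rfl
    refine ⟨_, mem_DB_iff.2 ⟨(composeGraph lP lQ).toAtoms N,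
      DGraph.toAtoms_ne (composeGraph_supported _ _), rfl⟩, sat_toAtoms_composeGraph lP lQ,
      s, t, h1, h2, h3.trans ?_⟩
    exact Nat.mul_le_mul (Nat.le_add_right _ _) (Nat.pow_le_pow_left (le_max_right _ _) _)
  · push Not at hne
    obtain ⟨rfl, rfl⟩ := hne
    obtain ⟨s, t, h1, h2, h3⟩ := exists_exec_fullProg_nil N
    refine ⟨_, mem_DB_iff.2 ⟨[], by simp, rfl⟩,
      defines_atomsFormula_nil.2 fun ν ν' => ⟨ν, trivial, trivial⟩, s, t, h1, h2, h3.trans ?_⟩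
    have : 1 ≤ max 1 b ^ 6 := Nat.one_le_pow _ _ (by omega)
    exact (Nat.le_add_left _ _).trans (Nat.le_mul_of_pos_right _ this)

end DiffBounds

theorem mainTheorem11 :
    DiffBounds.IsRelationClass DiffBounds.DB ∧
      DiffBounds.PolyLogarithmic DiffBounds.DB ∧
      DiffBounds.PowerSizeBound DiffBounds.DB 3 1 :=
  ⟨DiffBounds.isRelationClass_DB,
    ⟨3, 1, 6, by norm_num, by norm_num, by norm_num, DiffBounds.powerSizeBound_DB,
      DiffBounds.compositionTimeBound_DB⟩,
    DiffBounds.powerSizeBound_DB⟩
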